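/- Let $X$ be a finite set, $X^{\pm}=X\sqcup X^{-1}$, and let $F(X)$ be the free group on $X$. An $X$-digraph $S$ is a directed graph (loops and multiple edges allowed) whose edges are labelled by elements of $X$; an $x$-edge is an edge with label $x$. Let $VS$ and $ES$ denote its sets of vertices and edges. The degree of a vertex is the number of edge ends at it (a loop counts twice); a leaf is a vertex of degree one; $S$ is cyclically reduced if it has no leaf; $S$ is folded if no two distinct edges with the same label have the same initial vertex or the same terminal vertex. A Stallings graph is a finite, connected, folded $X$-digraph without leaves except possibly one vertex (the basepoint). A finite connected digraph has rank $\#E-\#V+1$. A Stallings graph $S$ satisfies Property $(L)$ if there are $x\in X$ and an edge $e$ such that $e$ is the unique $x$-edge of $S$, and $S-e$ has exactly two connected components, at least one of which has rank one. Let $m\in X^{\pm}$ and $C\subseteq X^{\pm}$ with $m\in C$ and $m^{-1}\notin C$. The Whitehead automorphism $\phi=(C,m)$ of $F(X)$ fixes $m$ and, for $x\in X$ with $x\neq m^{\pm1}$, sends $x$ to $m^{-\alpha}\,x\,m^{\beta}$, where $\beta=1$ if $x\in C$ and $\beta=0$ otherwise, and $\alpha=1$ if $x^{-1}\in C$ and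 $\alpha=0$ otherwise. The image $\phi(S)$ is obtained from $S$ by replacing every $x$-edge, for every $x\in X$, by a path labelled by the reduced word of $\phi(x)$, then folding (identifying edges that have the same label and the same initial, or the same terminal, vertex, until none remain to be identified), and then deleting leaves, together with their incident edges, until none remain. The automorphism $\phi$ reduces $S$ if $\#V\phi(S)<\#VS$. **Lemma.** Let $S$ be a cyclically reduced $X$-digraph satisfying Property $(L)$, and let $\phi=(C,m)$ be a Whitehead automorphism that reduces $S$. Then either $\phi(S)$ satisfies Property $(L)$, or some element of $X$ is not the label of any edge of $\phi(S)$. -/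

import Mathlib

universe u v

/-- An `X`-digraph: a directed graph (loops and multiple edges allowed) with edges labelled by
elements of `X`. `src e` is the initial vertex `e₋` and `tgt e` is the terminal vertex `e₊`. -/
structure XDigraph (X : Type u) where
  /-- The vertex set. -/
  V : Type v
  /-- The edge set. -/
  E : Type v
  /-- The initial vertex of an edge. -/
  src : E → V
  /-- The terminal vertex of an edge. -/
  tgt : E → V
  /-- The label of an edge. -/
  label : E → X

namespace XDigraph

variable {X : Type u}

/-- The link of `v`: all oriented edges of the dual digraph that end at `v`. Here `(e, true)` is the
edge `e` itself, ending at `e₊`, and `(e, false)` is its formal inverse, ending at `e₋`.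
In particular a loop at `v` contributes two elements. -/
def link (S : XDigraph.{u, v} X) (v : S.V) : Set (S.E × Bool) :=
  {a | (if a.2 then S.tgt a.1 else S.src a.1) = v}

/-- The label in `X^±` of an oriented edge; `(x, true)` is the letter `x` and `(x, false)` is the
letter `x⁻¹`. -/
def signedLabel (S : XDigraph.{u, v} X) (a : S.E × Bool) : X × Bool := (S.label a.1, a.2)

/-- A leaf is a vertex of degree one. -/
def IsLeaf (S : XDigraph.{u, v} X) (v : S.V) : Prop := ∃! a, a ∈ S.link v

/-- No vertex is a leaf. -/
def CyclicallyReduced (S : XDigraph.{u, v} X) : Prop := ∀ v, ¬ S.IsLeaf v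

/-- At every vertex, distinct elements of the link have distinct labels in `X^±`. -/
def Folded (S : XDigraph.{u, v} X) : Prop := ∀ v, Set.InjOn S.signedLabel (S.link v)

/-- Two vertices are equivalent if they are joined by a path (edges may be traversed in either
direction). -/
def joined (S : XDigraph.{u, v} X) : Setoid S.V :=
  Relation.EqvGen.setoid fun a b => ∃ e, S.src e = a ∧ S.tgt e = b

/-- The set of connected components. -/
def Component (S : XDigraph.{u, v} X) : Type v := Quotient S.joined

/-- Nonempty, and any two vertices are joined by a path. -/
def Connected (S : XDigraph.{u, v} X) : Prop := Nonempty S.V ∧ ∀ a b, S.joined a b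

/-- The vertices satisfying `p` and all the edges between them. -/
def induce (S : XDigraph.{u, v} X) (p : S.V → Prop) : XDigraph.{u, v} X where
  V := {v : S.V // p v}
  E := {e : S.E // p (S.src e) ∧ p (S.tgt e)}
  src e := ⟨S.src e.1, e.2.1⟩
  tgt e := ⟨S.tgt e.1, e.2.2⟩
  label e := S.label e.1

/-- A connected component, as an `X`-digraph. -/
def componentGraph (S : XDigraph.{u, v} X) (c : S.Component) : XDigraph.{u, v} X :=
  S.induce fun v => (Quotient.mk S.joined v : S.Component) = c

/-- The digraph `S - e`: the edge `e` is removed, all the vertices are kept. -/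
def deleteEdge (S : XDigraph.{u, v} X) (e : S.E) : XDigraph.{u, v} X where
  V := S.V
  E := {f : S.E // f ≠ e}
  src f := S.src f.1
  tgt f := S.tgt f.1
  label f := S.label f.1

/-- The rank `#E - #V + 1` of a finite connected digraph (the rank of its fundamental group). -/
noncomputable def rank (S : XDigraph.{u, v} X) : ℤ := (Nat.card S.E : ℤ) - Nat.card S.V + 1

/-- The Stallings graphs of finitely generated subgroups: finite, connected, folded, and without
leaves except possibly one vertex, the basepoint. -/
structure IsStallingsGraph (S : XDigraph.{u, v} X) : Prop where
  finite_V : Finite S.V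
  finite_E : Finite S.E
  connected : S.Connected
  folded : S.Folded
  core : ∃ b, ∀ v, v ≠ b → ¬ S.IsLeaf v

/-- Property (L): `S` is a Stallings graph that has, for some letter `x`, a unique `x`-edge `e`, and
`S - e` has two connected components, at least one of which is of rank one. -/
def PropertyL (S : XDigraph.{u, v} X) : Prop :=
  S.IsStallingsGraph ∧ ∃ (x : X) (e : S.E),
    (S.label e = x ∧ ∀ f, S.label f = x → f = e) ∧
    Nat.card (S.deleteEdge e).Component = 2 ∧
    ∃ c : (S.deleteEdge e).Component, ((S.deleteEdge e).componentGraph c).rank = 1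

/-- Some letter of `X` is not the label of any edge. -/
def OmitsLetter (S : XDigraph.{u, v} X) : Prop := ∃ x : X, ∀ e, S.label e ≠ x

/-! ### Subdivision -/

/-- The vertex at position `i` on the path of length `n` that replaces the edge `e`, where
`n` is the length of the word `w (S.label e)`. -/
def pathVertex (S : XDigraph.{u, v} X) (w : X → List (X × Bool)) (e : S.E) (i : ℕ) :
    S.V ⊕ (Σ e : S.E, Fin ((w (S.label e)).length - 1)) :=
  if i = 0 then Sum.inl (S.src e)
  else if h : i - 1 < (w (S.label e)).length - 1 then Sum.inr ⟨e, ⟨i - 1, h⟩⟩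
  else Sum.inl (S.tgt e)

/-- Every edge with label `x` is replaced by a path, from its initial to its terminal vertex, whose
label is the (nonempty) word `w x`. A letter `y⁻¹` in the word is read along a `y`-edge that is
traversed backwards. -/
def subdivide (S : XDigraph.{u, v} X) (w : X → List (X × Bool)) : XDigraph.{u, v} X where
  V := S.V ⊕ (Σ e : S.E, Fin ((w (S.label e)).length - 1))
  E := Σ e : S.E, Fin (w (S.label e)).length
  src p := if ((w (S.label p.1)).get p.2).2 then S.pathVertex w p.1 p.2
    else S.pathVertex w p.1 (p.2 + 1)
  tgt p := if ((w (S.label p.1)).get p.2).2 then S.pathVertex w p.1 (p.2 + 1)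
    else S.pathVertex w p.1 p.2
  label p := ((w (S.label p.1)).get p.2).1

/-! ### Folding -/

/-- Two vertices are identified by folding: the smallest equivalence relation for which edges with
the same label and identified initial vertices have identified terminal vertices, and vice versa. -/
inductive FoldRel (S : XDigraph.{u, v} X) : S.V → S.V → Prop
  | refl (a : S.V) : FoldRel S a a
  | symm {a b : S.V} : FoldRel S a b → FoldRel S b a
  | trans {a b c : S.V} : FoldRel S a b → FoldRel S b c → FoldRel S a c
  | coinitial {e f : S.E} : S.label e = S.label f → FoldRel S (S.src e) (S.src f) →
      FoldRel S (S.tgt e) (S.tgt f)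
  | coterminal {e f : S.E} : S.label e = S.label f → FoldRel S (S.tgt e) (S.tgt f) →
      FoldRel S (S.src e) (S.src f)

/-- Identification of vertices by folding. -/
def foldV (S : XDigraph.{u, v} X) : Setoid S.V :=
  ⟨S.FoldRel, ⟨FoldRel.refl, FoldRel.symm, FoldRel.trans⟩⟩

/-- Identification of edges by folding: edges with the same label and identified initial vertices
(equivalently, identified terminal vertices) are identified. -/
def foldE (S : XDigraph.{u, v} X) : Setoid S.E :=
  ⟨fun e f => S.label e = S.label f ∧ S.FoldRel (S.src e) (S.src f),
    fun _ => ⟨rfl, .refl _⟩, fun h => ⟨h.1.symm, h.2.symm⟩,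
    fun h k => ⟨h.1.trans k.1, h.2.trans k.2⟩⟩

/-- The folded digraph obtained by performing folds until none remain. -/
def fold (S : XDigraph.{u, v} X) : XDigraph.{u, v} X where
  V := Quotient S.foldV
  E := Quotient S.foldE
  src := Quotient.map S.src fun _ _ h => h.2
  tgt := Quotient.map S.tgt fun _ _ h => .coinitial h.1 h.2
  label := Quotient.lift S.label fun _ _ h => h.1

/-! ### Cyclic reduction -/

open Classical in
/-- Delete one leaf, together with the edge incident to it, if there is a leaf. -/
noncomputable def deleteLeaf (S : XDigraph.{u, v} X) : XDigraph.{u, v} X :=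
  if h : ∃ v, S.IsLeaf v then S.induce (fun v => v ≠ h.choose) else S

/-- Delete leaves until none remain; for a finite digraph at most `#V` deletions are possible. -/
noncomputable def cyclicReduction (S : XDigraph.{u, v} X) : XDigraph.{u, v} X :=
  deleteLeaf^[Nat.card S.V] S

/-! ### Automorphic images -/

/-- The image `φ(S)`: relabel each `x`-edge by the reduced word of `φ x`, fold, and delete leaves
until none remain. -/
noncomputable def image [DecidableEq X] (φ : FreeGroup X ≃* FreeGroup X) (S : XDigraph.{u, v} X) :
    XDigraph.{u, v} X :=
  (S.subdivide fun x => (φ (FreeGroup.of x)).toWord).fold.cyclicReduction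

/-- The automorphism `φ` reduces `S`: the image `φ(S)` has fewer vertices than `S`. -/
def Reduces [DecidableEq X] (φ : FreeGroup X ≃* FreeGroup X) (S : XDigraph.{u, v} X) : Prop :=
  Nat.card (S.image φ).V < Nat.card S.V

end XDigraph

/-! ### Whitehead automorphisms -/

namespace Whitehead

variable {X : Type u}

/-- `C ⊆ X^±` is an `m`-cut. -/
def IsCut (C : Set (X × Bool)) (m : X × Bool) : Prop := m ∈ C ∧ (m.1, !m.2) ∉ C

open Classical in
/-- The value at the letter `x` of the endomorphism that multiplies by `n` where `C` tells so:
`x` itself if `x = m^±`, and otherwise `x`, `n⁻¹ x`, `x n` or `n⁻¹ x n`, with a factor `n` on the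
right iff `x ∈ C` and a factor `n⁻¹` on the left iff `x⁻¹ ∈ C`. -/
noncomputable def value (C : Set (X × Bool)) (m : X × Bool) (n : FreeGroup X) (x : X) :
    FreeGroup X :=
  if x = m.1 then FreeGroup.of x
  else (if (x, false) ∈ C then n⁻¹ else 1) * FreeGroup.of x * (if (x, true) ∈ C then n else 1)

theorem lift_value_multiplier (C : Set (X × Bool)) (m : X × Bool) (n : FreeGroup X) :
    FreeGroup.lift (value C m n) (FreeGroup.mk [m]) = FreeGroup.mk [m] := by
  rcases m with ⟨y, b⟩
  cases b <;> simp [FreeGroup.lift_mk, value, FreeGroup.of, FreeGroup.inv_mk, FreeGroup.invRev]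

theorem lift_value_comp (C : Set (X × Bool)) (m : X × Bool) (n : FreeGroup X)
    (hn : n = FreeGroup.mk [m] ∨ n = (FreeGroup.mk [m])⁻¹) :
    (FreeGroup.lift (value C m n⁻¹)).comp (FreeGroup.lift (value C m n)) = MonoidHom.id _ := by
  have hfix : FreeGroup.lift (value C m n⁻¹) n = n := by
    rcases hn with h | h
    · rw [h]; exact lift_value_multiplier C m _
    · rw [h, map_inv, lift_value_multiplier]
  ext x
  by_cases hx : x = m.1
  · simp [value, hx]
  · by_cases h1 : (x, false) ∈ C <;> by_cases h2 : (x, true) ∈ C <;>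
      simp [value, hx, h1, h2, hfix, mul_assoc]

/-- The type II Whitehead automorphism `(C, m)` with multiplier `m ∈ X^±` and cut `C`. -/
noncomputable def aut (C : Set (X × Bool)) (m : X × Bool) : FreeGroup X ≃* FreeGroup X :=
  MonoidHom.toMulEquiv (FreeGroup.lift (value C m (FreeGroup.mk [m])))
    (FreeGroup.lift (value C m (FreeGroup.mk [m])⁻¹))
    (lift_value_comp C m _ (Or.inl rfl))
    (by simpa using lift_value_comp C m (FreeGroup.mk [m])⁻¹ (Or.inr rfl))

end Whitehead

namespace XDigraph

/-! ### Edge ends and their letters. -/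

variable {X : Type u}

/-! Folding the subdivided digraph has an explicit outcome, `whitehead`. At each vertex `v`, the
edge ends with label in `C` move to the origin of the oriented `m`-edge ending at `v`, or to a new
vertex if there is no such edge, and an `m`-edge runs from there to `v`. The vertices all of whose
letters lie in `C` become leaves, and deleting them creates no further leaf. So φ(S) is
`whiteheadCore`, by `nonempty_iso_image`, which rests on `nonempty_iso_fold_whitehead` and
`isCore_whitehead`.

Let M, B, N be the sets of vertices with some letter in `C`, with all letters in `C`, and with `m`
among their letters; B and N lie in M. Then φ(S) has |V∖B| + |M∖N| vertices and |M∖B| multiplier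
edges, while `S` has |N| multiplier edges; the other edges of the two digraphs correspond. Since
|M∖B| + |V| = |V∖B| + |M∖N| + |N|, the difference between the numbers of edges and of vertices is
unchanged.

If the separating edge `e` is not labelled by the multiplier, no multiplier edge crosses between the
two sides, so folding respects them. The count then holds on each side separately, and `e` still
witnesses Property (L) (`propertyL_whiteheadCore`). If `e` is the only multiplier edge, then |N| ≤
1, and the identity reads #Vφ(S) = #V + |M∖B| − |N|. A reduction forces M∖B to be empty, so the
multiplier has disappeared (`omitsLetter_whiteheadCore`). -/

/-- The vertex at which an oriented edge ends. -/
def tip (S : XDigraph.{u, v} X) (a : S.E × Bool) : S.V := if a.2 then S.tgt a.1 else S.src a.1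

@[simp] theorem tip_true (S : XDigraph.{u, v} X) (e : S.E) : S.tip (e, true) = S.tgt e := rfl

@[simp] theorem tip_false (S : XDigraph.{u, v} X) (e : S.E) : S.tip (e, false) = S.src e := rfl

/-- The signed labels of the oriented edges that end at `v`. -/
def letters (S : XDigraph.{u, v} X) (v : S.V) : Set (X × Bool) := S.signedLabel '' S.link v

theorem mem_letters (S : XDigraph.{u, v} X) (e : S.E) (b : Bool) :
    (S.label e, b) ∈ S.letters (S.tip (e, b)) := ⟨(e, b), rfl, rfl⟩

theorem exists_of_mem_letters {S : XDigraph.{u, v} X} {v : S.V} {y : X × Bool}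
    (h : y ∈ S.letters v) : ∃ e, S.label e = y.1 ∧ S.tip (e, y.2) = v := by
  obtain ⟨a, ha, rfl⟩ := h
  exact ⟨a.1, rfl, ha⟩

theorem Folded.eq_of_tip {S : XDigraph.{u, v} X} (hS : S.Folded) {e f : S.E} {b : Bool}
    (hl : S.label e = S.label f) (ht : S.tip (e, b) = S.tip (f, b)) : e = f := by
  have := hS (S.tip (f, b)) (show (e, b) ∈ S.link _ from ht) (show (f, b) ∈ S.link _ from rfl)
    (by simp [signedLabel, hl])
  exact congrArg Prod.fst this

theorem folded_of_eq {S : XDigraph.{u, v} X}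
    (h : ∀ e f b, S.label e = S.label f → S.tip (e, b) = S.tip (f, b) → e = f) : S.Folded := by
  rintro v ⟨e, b⟩ he ⟨f, b'⟩ hf hl
  obtain ⟨h1, rfl⟩ := Prod.mk.inj hl
  rw [h e f b h1 ((show S.tip (e, b) = v from he).trans (show S.tip (f, b) = v from hf).symm)]

theorem isLeaf_iff {S : XDigraph.{u, v} X} {v : S.V} : S.IsLeaf v ↔ ∃! a, S.tip a = v := Iff.rfl

/-! ### Paths -/

theorem joined_edge (S : XDigraph.{u, v} X) (e : S.E) : S.joined (S.src e) (S.tgt e) :=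
  .rel _ _ ⟨e, rfl, rfl⟩

/-- Minimality of the generated equivalence relation; every later transfer of connectivity goes
through it. -/
theorem rel_of_joined {S : XDigraph.{u, v} X} (r : Setoid S.V) (h : ∀ e, r (S.src e) (S.tgt e))
    {a b : S.V} (hab : S.joined a b) : r a b := by
  change Relation.EqvGen _ a b at hab
  induction hab with
  | rel a b h' => obtain ⟨e, rfl, rfl⟩ := h'; exact h e
  | refl a => exact r.refl a
  | symm a b _ ih => exact r.symm ih
  | trans a b c _ _ ih1 ih2 => exact r.trans ih1 ih2

theorem iff_of_joined {S : XDigraph.{u, v} X} (p : S.V → Prop)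
    (h : ∀ e, p (S.src e) ↔ p (S.tgt e)) {a b : S.V} (hab : S.joined a b) : p a ↔ p b :=
  rel_of_joined ⟨fun a b => (p a ↔ p b), fun _ => Iff.rfl, Iff.symm, Iff.trans⟩ h hab

theorem joined_map {S T : XDigraph.{u, v} X} (f : S.V → T.V)
    (h : ∀ e, T.joined (f (S.src e)) (f (S.tgt e))) {a b : S.V} (hab : S.joined a b) :
    T.joined (f a) (f b) :=
  rel_of_joined (T.joined.comap f) h hab

/-- For an isolated `v`, being equal to `v` is constant along edges, so connectedness would make `v`
an endpoint of `e`. -/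
theorem Connected.exists_tip {S : XDigraph.{u, v} X} (hS : S.Connected) (e : S.E) (v : S.V) :
    ∃ a, S.tip a = v := by
  by_contra! h
  have := iff_of_joined (fun w => w = v)
    (fun f => iff_of_false (h (f, false)) (h (f, true))) (hS.2 v (S.src e))
  exact h (e, false) (this.1 rfl)

/-! ### Isomorphisms -/

/-- Isomorphisms of `X`-digraphs. -/
structure Iso (G H : XDigraph.{u, v} X) where
  /-- The bijection between the vertices. -/
  V : G.V ≃ H.V
  /-- The bijection between the edges. -/
  E : G.E ≃ H.E
  src_eq : ∀ e, H.src (E e) = V (G.src e)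
  tgt_eq : ∀ e, H.tgt (E e) = V (G.tgt e)
  label_eq : ∀ e, H.label (E e) = G.label e

namespace Iso

variable {G H K : XDigraph.{u, v} X}

/-- Composition of isomorphisms. -/
def trans (φ : Iso G H) (ψ : Iso H K) : Iso G K where
  V := φ.V.trans ψ.V
  E := φ.E.trans ψ.E
  src_eq e := by simp [ψ.src_eq, φ.src_eq]
  tgt_eq e := by simp [ψ.tgt_eq, φ.tgt_eq]
  label_eq e := by simp [ψ.label_eq, φ.label_eq]

theorem tip_eq (φ : Iso G H) (e : G.E) (b : Bool) : H.tip (φ.E e, b) = φ.V (G.tip (e, b)) := by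
  cases b
  · exact φ.src_eq e
  · exact φ.tgt_eq e

/-- The isomorphism between induced subgraphs. -/
def induce (φ : Iso G H) (p : H.V → Prop) : Iso (G.induce fun v => p (φ.V v)) (H.induce p) where
  V := φ.V.subtypeEquiv fun _ => Iff.rfl
  E := φ.E.subtypeEquiv fun e => by simp only [φ.src_eq, φ.tgt_eq]
  src_eq e := Subtype.ext (φ.src_eq e.1)
  tgt_eq e := Subtype.ext (φ.tgt_eq e.1)
  label_eq e := φ.label_eq e.1

/-- A digraph is its own subgraph induced by all its vertices. -/
def induceOfForall (G : XDigraph.{u, v} X) (p : G.V → Prop) (h : ∀ v, p v) :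
    Iso G (G.induce p) where
  V := (Equiv.subtypeUnivEquiv h).symm
  E := (Equiv.subtypeUnivEquiv fun _ => ⟨h _, h _⟩).symm
  src_eq _ := rfl
  tgt_eq _ := rfl
  label_eq _ := rfl

/-- An induced subgraph of an induced subgraph. -/
def induceInduce (G : XDigraph.{u, v} X) (q p : G.V → Prop) (h : ∀ v, p v → q v) :
    Iso ((G.induce q).induce fun v => p v.1) (G.induce p) where
  V := Equiv.subtypeSubtypeEquivSubtype (h _)
  E :=
    { toFun := fun e => ⟨e.1.1, e.2⟩
      invFun := fun e => ⟨⟨e.1, h _ e.2.1, h _ e.2.2⟩, e.2⟩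
      left_inv := fun _ => rfl
      right_inv := fun _ => rfl }
  src_eq _ := rfl
  tgt_eq _ := rfl
  label_eq _ := rfl

end Iso

/-! ### Folding -/

/-- A folded digraph `T` is the result of folding `G` as soon as there is a surjective morphism
from `G` to `T` that identifies only vertices that are identified by folding. -/
theorem nonempty_iso_fold {G T : XDigraph.{u, v} X} (hT : T.Folded) (fV : G.V → T.V)
    (fE : G.E → T.E) (hsrc : ∀ e, T.src (fE e) = fV (G.src e))
    (htgt : ∀ e, T.tgt (fE e) = fV (G.tgt e)) (hlabel : ∀ e, T.label (fE e) = G.label e)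
    (hV : Function.Surjective fV) (hE : Function.Surjective fE)
    (hker : ∀ a b, fV a = fV b → G.FoldRel a b) : Nonempty (Iso G.fold T) := by
  -- As `T` is folded, the kernel of `fV` is closed under the folding rules, hence contains
  -- `FoldRel`; `hker` is the other inclusion.
  have key : ∀ a b, G.FoldRel a b → fV a = fV b := by
    intro a b h
    induction h with
    | refl a => rfl
    | symm _ ih => exact ih.symm
    | trans _ _ ih1 ih2 => exact ih1.trans ih2
    | @coinitial e f hl _ ih =>
      have : fE e = fE f := hT.eq_of_tip (b := false) (by rw [hlabel, hlabel, hl])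
        (by rw [tip_false, tip_false, hsrc, hsrc, ih])
      rw [← htgt, ← htgt, this]
    | @coterminal e f hl _ ih =>
      have : fE e = fE f := hT.eq_of_tip (b := true) (by rw [hlabel, hlabel, hl])
        (by rw [tip_true, tip_true, htgt, htgt, ih])
      rw [← hsrc, ← hsrc, this]
  have keyE : ∀ e f, G.foldE e f → fE e = fE f := fun e f h =>
    hT.eq_of_tip (b := false) (by rw [hlabel, hlabel, h.1])
      (by rw [tip_false, tip_false, hsrc, hsrc, key _ _ h.2])
  refine ⟨⟨Equiv.ofBijective (Quotient.lift fV key : G.fold.V → T.V) ⟨?_, ?_⟩,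
    Equiv.ofBijective (Quotient.lift fE keyE : G.fold.E → T.E) ⟨?_, ?_⟩, ?_, ?_, ?_⟩⟩
  · rintro ⟨a⟩ ⟨b⟩ h
    exact Quotient.sound (hker a b h)
  · intro t
    obtain ⟨a, rfl⟩ := hV t
    exact ⟨Quotient.mk _ a, rfl⟩
  · rintro ⟨e⟩ ⟨f⟩ h
    have h : fE e = fE f := h
    exact Quotient.sound ⟨by rw [← hlabel, h, hlabel], hker _ _ (by rw [← hsrc, h, hsrc])⟩
  · intro t
    obtain ⟨a, rfl⟩ := hE t
    exact ⟨Quotient.mk _ a, rfl⟩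
  · rintro ⟨e⟩; exact hsrc e
  · rintro ⟨e⟩; exact htgt e
  · rintro ⟨e⟩; exact hlabel e

/-! ### Deletion of leaves -/

/-- The vertices satisfying `p` have degree at least two in the subgraph that they induce, and all
the other vertices are leaves attached to it. -/
structure IsCore (G : XDigraph.{u, v} X) (p : G.V → Prop) : Prop where
  two : ∀ v, p v → ∃ a b, a ≠ b ∧ (G.tip a = v ∧ p (G.src a.1) ∧ p (G.tgt a.1)) ∧
    (G.tip b = v ∧ p (G.src b.1) ∧ p (G.tgt b.1))
  leaf : ∀ v, ¬ p v → ∃ a, G.tip a = v ∧ (∀ b, G.tip b = v → b = a) ∧ p (G.tip (a.1, !a.2))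

namespace IsCore

variable {G H : XDigraph.{u, v} X} {p : G.V → Prop}

theorem not_isLeaf_of_two {v : G.V} {a b : G.E × Bool} (hab : a ≠ b) (ha : G.tip a = v)
    (hb : G.tip b = v) : ¬ G.IsLeaf v :=
  fun h => hab (h.unique ha hb)

theorem cyclicallyReduced_induce (h : G.IsCore p) : (G.induce p).CyclicallyReduced := by
  rintro ⟨v, hv⟩
  obtain ⟨⟨e, b⟩, ⟨f, c⟩, hab, ⟨ha, ha'⟩, hb, hb'⟩ := h.two v hv
  refine not_isLeaf_of_two (a := (⟨e, ha'⟩, b)) (b := (⟨f, hb'⟩, c)) ?_ ?_ ?_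
  · intro h
    obtain ⟨h1, h2⟩ := Prod.mk.inj h
    exact hab (by rw [Subtype.mk.inj h1, h2])
  · cases b <;> exact Subtype.ext ha
  · cases c <;> exact Subtype.ext hb

/-- The only neighbour of a vertex outside the core lies in the core, so deleting `l` leaves the
edges at the other leaves untouched. -/
theorem induce_ne (h : G.IsCore p) {l : G.V} (hl : ¬ p l) :
    (G.induce fun v => v ≠ l).IsCore fun v => p v.1 := by
  have hne : ∀ {v}, p v → v ≠ l := fun hv hvl => hl (hvl ▸ hv)
  constructor
  · rintro ⟨v, hvl⟩ hv
    obtain ⟨⟨e, b⟩, ⟨f, c⟩, hab, ⟨ha, ha'⟩, hb, hb'⟩ := h.two v hv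
    refine ⟨(⟨e, hne ha'.1, hne ha'.2⟩, b), (⟨f, hne hb'.1, hne hb'.2⟩, c), ?_, ⟨?_, ha'⟩, ?_, hb'⟩
    · intro h
      obtain ⟨h1, h2⟩ := Prod.mk.inj h
      exact hab (by rw [Subtype.mk.inj h1, h2])
    · cases b <;> exact Subtype.ext ha
    · cases c <;> exact Subtype.ext hb
  · rintro ⟨v, hvl⟩ hv
    obtain ⟨⟨e, b⟩, ha, hu, hp⟩ := h.leaf v hv
    have he : G.src e ≠ l ∧ G.tgt e ≠ l := by
      cases b
      · exact ⟨fun h => hvl (ha.symm.trans h), hne hp⟩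
      · exact ⟨hne hp, fun h => hvl (ha.symm.trans h)⟩
    refine ⟨(⟨e, he⟩, b), ?_, ?_, ?_⟩
    · cases b <;> exact Subtype.ext ha
    · rintro ⟨f, c⟩ hf
      have := hu (f.1, c) (by cases c <;> exact congrArg Subtype.val hf)
      obtain ⟨h1, h2⟩ := Prod.mk.inj this
      exact Prod.ext (Subtype.ext h1) h2
    · cases b <;> exact hp

theorem comap {p : H.V → Prop} (h : H.IsCore p) (φ : Iso G H) :
    G.IsCore fun v => p (φ.V v) := by
  have tip_symm : ∀ a : H.E × Bool, φ.V (G.tip (φ.E.symm a.1, a.2)) = H.tip a := by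
    intro a; rw [← φ.tip_eq]; simp
  have src_symm : ∀ e, φ.V (G.src (φ.E.symm e)) = H.src e := by
    intro e; rw [← φ.src_eq]; simp
  have tgt_symm : ∀ e, φ.V (G.tgt (φ.E.symm e)) = H.tgt e := by
    intro e; rw [← φ.tgt_eq]; simp
  constructor
  · intro v hv
    obtain ⟨⟨e, b⟩, ⟨f, c⟩, hab, ⟨ha, ha'⟩, hb, hb'⟩ := h.two _ hv
    refine ⟨(φ.E.symm e, b), (φ.E.symm f, c), ?_, ⟨φ.V.injective ((tip_symm (e, b)).trans ha), ?_⟩,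
      φ.V.injective ((tip_symm (f, c)).trans hb), ?_⟩
    · simpa using hab
    · simpa only [src_symm, tgt_symm] using ha'
    · simpa only [src_symm, tgt_symm] using hb'
  · intro v hv
    obtain ⟨⟨e, b⟩, ha, hu, hp⟩ := h.leaf _ hv
    refine ⟨(φ.E.symm e, b), φ.V.injective ((tip_symm (e, b)).trans ha), ?_, ?_⟩
    · rintro ⟨f, c⟩ hf
      have := hu (φ.E f, c) (by rw [φ.tip_eq, hf])
      obtain ⟨h1, h2⟩ := Prod.mk.inj this
      exact Prod.ext (by simp [← h1]) h2
    · rw [tip_symm (e, !b)]; exact hp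

/-- `deleteLeaf` picks an arbitrary leaf, but a leaf is never a core vertex, so the order of
deletion is irrelevant. Surplus iterations do nothing. -/
theorem nonempty_iso_iterate (n : ℕ) : ∀ {G : XDigraph.{u, v} X} [Finite G.V] {p : G.V → Prop},
    G.IsCore p → Nat.card {v // ¬ p v} ≤ n → Nonempty (Iso (deleteLeaf^[n] G) (G.induce p)) := by
  induction n with
  | zero =>
    intro G _ p h hn
    have : IsEmpty {v // ¬ p v} := (Nat.card_eq_zero.1 (Nat.le_zero.1 hn)).resolve_right
      fun h => h.not_finite inferInstance
    exact ⟨Iso.induceOfForall G p fun v => by_contra fun hv => this.false ⟨v, hv⟩⟩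
  | succ n ih =>
    intro G _ p h hn
    rw [Function.iterate_succ_apply]
    by_cases hl : ∃ v, G.IsLeaf v
    · have hp : ¬ p hl.choose := by
        intro hp
        obtain ⟨a, b, hab, ha, hb⟩ := h.two _ hp
        exact not_isLeaf_of_two hab ha.1 hb.1 hl.choose_spec
      have hd : deleteLeaf G = G.induce (fun v => v ≠ hl.choose) := dif_pos hl
      rw [hd]
      have : Finite (G.induce (fun v => v ≠ hl.choose)).V :=
        inferInstanceAs (Finite {v : G.V // v ≠ hl.choose})
      refine (ih (h.induce_ne hp) ?_).map fun φ => φ.trans (Iso.induceInduce G _ p ?_)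
      · refine Nat.le_of_lt_succ (lt_of_lt_of_le ?_ hn)
        change Nat.card {v : {v : G.V // v ≠ hl.choose} // ¬ p v.1} < _
        have hinj : Function.Injective
            (fun v : {v : {v : G.V // v ≠ hl.choose} // ¬ p v.1} => (⟨v.1.1, v.2⟩ : {v // ¬ p v})) :=
          fun a b hab => Subtype.ext (Subtype.ext (Subtype.mk.inj hab))
        -- Strict, because the deleted leaf is missed by the inclusion.
        refine lt_of_le_of_ne (Nat.card_le_card_of_injective _ hinj) fun hcard => ?_
        obtain ⟨a, ha⟩ := ((Nat.bijective_iff_injective_and_card _).2 ⟨hinj, hcard⟩).2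
          ⟨hl.choose, hp⟩
        exact a.1.2 (Subtype.mk.inj ha)
      · exact fun v hv hvl => hp (hvl ▸ hv)
    · have hd : deleteLeaf G = G := dif_neg hl
      rw [hd]
      refine ih h ?_
      have : IsEmpty {v // ¬ p v} := ⟨fun v => by
        obtain ⟨a, ha, hu, -⟩ := h.leaf _ v.2
        exact hl ⟨v.1, a, ha, hu⟩⟩
      simp

theorem nonempty_iso_cyclicReduction [Finite G.V] (h : G.IsCore p) :
    Nonempty (Iso G.cyclicReduction (G.induce p)) :=
  h.nonempty_iso_iterate _ (Finite.card_subtype_le _)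

end IsCore

/-! ### Property (L) in terms of bipartitions of the vertices -/

/-- Removing `e` leaves two components, `side` being the vertex set of one of them, of rank one. -/
structure Splits (S : XDigraph.{u, v} X) (e : S.E) (side : S.V → Prop) : Prop where
  side_iff : ∀ f, f ≠ e → (side (S.src f) ↔ side (S.tgt f))
  joined : ∀ a b, (side a ↔ side b) → (S.deleteEdge e).joined a b
  exists_side : ∃ a, side a
  exists_not_side : ∃ a, ¬ side a
  card_eq : Nat.card {f // f ≠ e ∧ side (S.src f)} = Nat.card {v // side v}

theorem Splits.iff_of_joined {S : XDigraph.{u, v} X} {e : S.E} {side : S.V → Prop}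
    (h : S.Splits e side) {a b : S.V} (hab : (S.deleteEdge e).joined a b) : side a ↔ side b :=
  XDigraph.iff_of_joined (S := S.deleteEdge e) side (fun f => h.side_iff f.1 f.2) hab

/-- An edge other than `e` has both ends on the same side, so testing its source suffices to count
the edges of the component. -/
theorem rank_componentGraph_eq_one_iff {S : XDigraph.{u, v} X} {e : S.E} {side : S.V → Prop}
    (h1 : ∀ f, f ≠ e → (side (S.src f) ↔ side (S.tgt f))) (c : (S.deleteEdge e).Component)
    (hc : ∀ v, Quotient.mk (S.deleteEdge e).joined v = c ↔ side v) :
    ((S.deleteEdge e).componentGraph c).rank = 1 ↔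
      Nat.card {f // f ≠ e ∧ side (S.src f)} = Nat.card {v // side v} := by
  have hE : Nat.card ((S.deleteEdge e).componentGraph c).E =
      Nat.card {f // f ≠ e ∧ side (S.src f)} :=
    Nat.card_congr
      { toFun := fun f => ⟨f.1.1, f.1.2, (hc _).1 f.2.1⟩
        invFun := fun f => ⟨⟨f.1, f.2.1⟩, (hc _).2 f.2.2, (hc _).2 ((h1 _ f.2.1).1 f.2.2)⟩
        left_inv := fun _ => rfl
        right_inv := fun _ => rfl }
  have hV : Nat.card ((S.deleteEdge e).componentGraph c).V = Nat.card {v // side v} :=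
    Nat.card_congr (Equiv.subtypeEquivRight hc)
  rw [rank, hE, hV]
  omega

/-- A predicate on vertices is easier to transport than a quotient: it replaces the pair of
components and can be pulled back along maps of vertices. -/
theorem propertyL_iff (S : XDigraph.{u, v} X) : S.PropertyL ↔ S.IsStallingsGraph ∧
    ∃ e, (∀ f, S.label f = S.label e → f = e) ∧ ∃ side, S.Splits e side := by
  refine and_congr_right fun hS => ⟨?_, ?_⟩
  · rintro ⟨x, e, ⟨rfl, hu⟩, h2, c, hc⟩
    have h1 : ∀ f, f ≠ e → (Quotient.mk (S.deleteEdge e).joined (S.src f) = c ↔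
        Quotient.mk (S.deleteEdge e).joined (S.tgt f) = c) := fun f hf => by
      have heq := Quotient.sound (s := (S.deleteEdge e).joined)
        ((S.deleteEdge e).joined_edge (⟨f, hf⟩ : {f // f ≠ e}))
      exact ⟨fun h => heq.symm.trans h, fun h => heq.trans h⟩
    obtain ⟨d, hd, huniv⟩ := (Nat.card_eq_two_iff' c).1 h2
    refine ⟨e, hu, fun v => Quotient.mk (S.deleteEdge e).joined v = c, h1, ?_, ?_, ?_,
      (rank_componentGraph_eq_one_iff h1 c fun _ => Iff.rfl).1 hc⟩
    · intro a b hab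
      refine Quotient.exact (s := (S.deleteEdge e).joined) ?_
      by_cases ha : Quotient.mk (S.deleteEdge e).joined a = c
      · exact ha.trans (hab.1 ha).symm
      · exact (huniv _ ha).trans (huniv _ (fun hb => ha (hab.2 hb))).symm
    · exact Quotient.exists_rep c
    · obtain ⟨a, ha⟩ := Quotient.exists_rep d
      exact ⟨a, fun h => hd (ha.symm.trans h)⟩
  · rintro ⟨e, hu, side, h⟩
    obtain ⟨a, ha⟩ := h.exists_side
    obtain ⟨b, hb⟩ := h.exists_not_side
    have hc : ∀ v, Quotient.mk (S.deleteEdge e).joined v =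
        Quotient.mk (S.deleteEdge e).joined a ↔ side v := fun v =>
      ⟨fun hv => (h.iff_of_joined (Quotient.exact hv)).2 ha,
        fun hv => Quotient.sound (h.joined _ _ (iff_of_true hv ha))⟩
    refine ⟨_, e, ⟨rfl, hu⟩, ?_, Quotient.mk _ a,
      (rank_componentGraph_eq_one_iff h.side_iff _ hc).2 h.card_eq⟩
    refine (Nat.card_eq_two_iff' (α := (S.deleteEdge e).Component)
      (Quotient.mk (S.deleteEdge e).joined a)).2 ⟨Quotient.mk _ b, fun hba => hb ((hc b).1 hba), ?_⟩
    rintro ⟨v⟩ hv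
    exact Quotient.sound (h.joined _ _ (iff_of_false (fun h' => hv ((hc v).2 h')) hb))

/-! ### Invariance of Property (L) under isomorphism. -/

namespace Iso

variable {G H : XDigraph.{u, v} X}

theorem exists_edge_eq (φ : Iso G H) (f : H.E) : ∃ e, φ.E e = f ∧ φ.V (G.src e) = H.src f ∧
    φ.V (G.tgt e) = H.tgt f := by
  obtain ⟨e, rfl⟩ := φ.E.surjective f
  exact ⟨e, rfl, (φ.src_eq e).symm, (φ.tgt_eq e).symm⟩

theorem joined_of_joined (φ : Iso G H) {a b : G.V} (h : H.joined (φ.V a) (φ.V b)) :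
    G.joined a b := by
  have := joined_map (T := G) φ.V.symm (fun f => ?_) h
  · simpa using this
  · obtain ⟨e, rfl, h1, h2⟩ := φ.exists_edge_eq f
    rw [← h1, ← h2]
    simpa using G.joined_edge e

/-- Isomorphic digraphs remain isomorphic when corresponding edges are removed. -/
def deleteEdge (φ : Iso G H) (e : G.E) : Iso (G.deleteEdge e) (H.deleteEdge (φ.E e)) where
  V := φ.V
  E := φ.E.subtypeEquiv fun f => by simp
  src_eq f := φ.src_eq f.1
  tgt_eq f := φ.tgt_eq f.1
  label_eq f := φ.label_eq f.1

theorem isLeaf_iff (φ : Iso G H) (v : G.V) : H.IsLeaf (φ.V v) ↔ G.IsLeaf v := by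
  have : ∀ a : G.E × Bool, H.tip ((φ.E.prodCongr (Equiv.refl Bool)) a) = φ.V v ↔ G.tip a = v := by
    rintro ⟨e, b⟩
    simp [φ.tip_eq]
  rw [XDigraph.isLeaf_iff, XDigraph.isLeaf_iff]
  exact (Equiv.existsUnique_congr (φ.E.prodCongr (Equiv.refl Bool)) fun {a} => (this a).symm).symm

theorem isStallingsGraph (φ : Iso G H) (h : H.IsStallingsGraph) : G.IsStallingsGraph where
  finite_V := have := h.finite_V; Finite.of_equiv _ φ.V.symm
  finite_E := have := h.finite_E; Finite.of_equiv _ φ.E.symm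
  connected := ⟨h.connected.1.map φ.V.symm, fun _ _ => φ.joined_of_joined (h.connected.2 _ _)⟩
  folded := folded_of_eq fun e f b hl ht => φ.E.injective <|
    h.folded.eq_of_tip (b := b) (by rw [φ.label_eq, φ.label_eq, hl])
      (by rw [φ.tip_eq, φ.tip_eq, ht])
  core := by
    obtain ⟨b, hb⟩ := h.core
    refine ⟨φ.V.symm b, fun v hv => ?_⟩
    rw [← φ.isLeaf_iff]
    exact hb _ fun h => hv (by simp [← h])

theorem propertyL (φ : Iso G H) (h : H.PropertyL) : G.PropertyL := by
  rw [propertyL_iff] at h ⊢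
  obtain ⟨hH, e', hu, side, hs⟩ := h
  obtain ⟨e, rfl⟩ := φ.E.surjective e'
  refine ⟨φ.isStallingsGraph hH, e, fun f hf => φ.E.injective (hu _ ?_),
    fun v => side (φ.V v), ?_, ?_, ?_, ?_, ?_⟩
  · rw [φ.label_eq, φ.label_eq, hf]
  · intro f hf
    rw [← φ.src_eq, ← φ.tgt_eq]
    exact hs.side_iff _ (φ.E.injective.ne hf)
  · exact fun a b hab => (φ.deleteEdge e).joined_of_joined (hs.joined _ _ hab)
  · obtain ⟨a, ha⟩ := hs.exists_side
    exact ⟨φ.V.symm a, by simpa using ha⟩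
  · obtain ⟨a, ha⟩ := hs.exists_not_side
    exact ⟨φ.V.symm a, by simpa using ha⟩
  · rw [Nat.card_congr (φ.V.subtypeEquiv (p := fun v => side (φ.V v)) (q := side)
      fun _ => Iff.rfl), ← hs.card_eq]
    exact Nat.card_congr (φ.E.subtypeEquiv fun f => by simp [φ.src_eq])

theorem omitsLetter (φ : Iso G H) (h : H.OmitsLetter) : G.OmitsLetter := by
  obtain ⟨x, hx⟩ := h
  exact ⟨x, fun e he => hx (φ.E e) ((φ.label_eq e).trans he)⟩

end Iso

/-! ### The action of a Whitehead automorphism on a folded digraph -/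

section Whitehead

variable (S : XDigraph.{u, v} X) (C : Set (X × Bool)) (m : X × Bool)

/-- Some oriented edge ending at `v` has its label in `C`. -/
def Meets (v : S.V) : Prop := ∃ y ∈ S.letters v, y ∈ C

open Classical in
/-- The vertex to which the ends at `v` with labels in `C` are moved: the origin of the `m`-edge
that ends at `v` if there is one, and otherwise a new vertex. -/
noncomputable def primed (v : S.V) : S.V ⊕ {v // S.Meets C v ∧ m ∉ S.letters v} :=
  if h : m ∈ S.letters v then .inl (S.tip ((exists_of_mem_letters h).choose, !m.2))
  else if h' : S.Meets C v then .inr ⟨v, h', h⟩ else .inl v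

open Classical in
/-- The vertex to which an end of an edge is moved. -/
noncomputable def attach (a : S.E × Bool) : S.V ⊕ {v // S.Meets C v ∧ m ∉ S.letters v} :=
  if (S.label a.1, a.2) ∈ C then S.primed C m (S.tip a) else .inl (S.tip a)

/-- The ends of the edges of `S.whitehead C m`. -/
noncomputable def whiteheadTip :
    ({e // S.label e ≠ m.1} ⊕ {v // S.Meets C v}) × Bool →
      S.V ⊕ {v // S.Meets C v ∧ m ∉ S.letters v}
  | (.inl f, b) => S.attach C m (f.1, b)
  | (.inr v, b) => if b = m.2 then .inl v.1 else S.primed C m v.1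

/-- The digraph obtained from `S` by moving the ends of edges at `v` with labels in `C` to
`S.primed C m v` and joining the latter to `v` by an `m`-edge, for every vertex `v`. -/
noncomputable abbrev whitehead : XDigraph.{u, v} X where
  V := S.V ⊕ {v // S.Meets C v ∧ m ∉ S.letters v}
  E := {e // S.label e ≠ m.1} ⊕ {v // S.Meets C v}
  src e := S.whiteheadTip C m (e, false)
  tgt e := S.whiteheadTip C m (e, true)
  label := Sum.elim (fun e => S.label e.1) fun _ => m.1

/-- The vertices of `S.whitehead C m` that are not leaves. -/
def Survives : S.V ⊕ {v // S.Meets C v ∧ m ∉ S.letters v} → Prop :=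
  Sum.elim (fun v => ¬ S.letters v ⊆ C) fun _ => True

variable {S C m}

theorem whitehead_tip (a) : (S.whitehead C m).tip a = S.whiteheadTip C m a := by
  rcases a with ⟨e, _ | _⟩ <;> rfl

theorem whiteheadTip_inl (f : {e // S.label e ≠ m.1}) (b : Bool) :
    S.whiteheadTip C m (.inl f, b) = S.attach C m (f.1, b) := rfl

@[simp] theorem whiteheadTip_inr_self (v : {v // S.Meets C v}) :
    S.whiteheadTip C m (.inr v, m.2) = .inl v.1 := if_pos rfl

@[simp] theorem whiteheadTip_inr_not (v : {v // S.Meets C v}) :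
    S.whiteheadTip C m (.inr v, !m.2) = S.primed C m v.1 := if_neg (by simp)

theorem attach_of_mem {a : S.E × Bool} (h : (S.label a.1, a.2) ∈ C) :
    S.attach C m a = S.primed C m (S.tip a) := if_pos h

theorem attach_of_notMem {a : S.E × Bool} (h : (S.label a.1, a.2) ∉ C) :
    S.attach C m a = .inl (S.tip a) := if_neg h

theorem primed_of_notMem {v : S.V} (h' : S.Meets C v) (h : m ∉ S.letters v) :
    S.primed C m v = .inr ⟨v, h', h⟩ := by
  rw [primed, dif_neg h, dif_pos h']

/-- Foldedness makes the `m`-edge ending at a vertex unique, so the choice in `primed` is harmless.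
-/
theorem primed_tip (hS : S.Folded) {f : S.E} (hf : S.label f = m.1) :
    S.primed C m (S.tip (f, m.2)) = .inl (S.tip (f, !m.2)) := by
  have h : m ∈ S.letters (S.tip (f, m.2)) := ⟨(f, m.2), rfl, Prod.ext hf rfl⟩
  obtain ⟨h1, h2⟩ := (exists_of_mem_letters h).choose_spec
  rw [primed, dif_pos h, hS.eq_of_tip (h1.trans hf.symm) h2]

theorem exists_of_primed_eq_inl (hS : S.Folded) {v u : S.V} (hv : S.Meets C v)
    (h : S.primed C m v = .inl u) :
    ∃ f, S.label f = m.1 ∧ S.tip (f, m.2) = v ∧ S.tip (f, !m.2) = u := by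
  by_cases hm : m ∈ S.letters v
  · obtain ⟨f, hf, rfl⟩ := exists_of_mem_letters hm
    rw [primed_tip hS hf] at h
    exact ⟨f, hf, rfl, Sum.inl_injective h⟩
  · rw [primed_of_notMem hv hm] at h
    cases h

/-- An old value determines the `m`-edge leaving it, by foldedness, and hence `v`; a new value
records `v` itself. -/
theorem primed_injOn (hS : S.Folded) {v w : S.V} (hv : S.Meets C v) (hw : S.Meets C w)
    (h : S.primed C m v = S.primed C m w) : v = w := by
  cases hu : S.primed C m w with
  | inl u =>
    obtain ⟨f, hf, rfl, hfu⟩ := exists_of_primed_eq_inl hS hv (h.trans hu)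
    obtain ⟨g, hg, rfl, hgu⟩ := exists_of_primed_eq_inl hS hw hu
    rw [hS.eq_of_tip (hf.trans hg.symm) (hfu.trans hgu.symm)]
  | inr u =>
    have key : ∀ x, S.Meets C x → S.primed C m x = .inr u → x = u.1 := by
      intro x hx h
      by_cases hm : m ∈ S.letters x
      · obtain ⟨f, hf, rfl⟩ := exists_of_mem_letters hm
        rw [primed_tip hS hf] at h
        cases h
      · rw [primed_of_notMem hx hm] at h
        exact congrArg Subtype.val (Sum.inr_injective h)
    rw [key v hv (h.trans hu), key w hw hu]

theorem meets_tip {e : S.E} {b : Bool} (h : (S.label e, b) ∈ C) : S.Meets C (S.tip (e, b)) :=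
  ⟨_, S.mem_letters e b, h⟩

theorem inv_mem_letters {f : S.E} (hf : S.label f = m.1) :
    (m.1, !m.2) ∈ S.letters (S.tip (f, !m.2)) := hf ▸ S.mem_letters f (!m.2)

theorem mem_letters_of_label {f : S.E} (hf : S.label f = m.1) :
    m ∈ S.letters (S.tip (f, m.2)) := ⟨(f, m.2), rfl, Prod.ext hf rfl⟩

/-- The origin of an `m`-edge has the letter `m⁻¹`, which a cut excludes. Hence every `primed`
vertex survives. -/
theorem letters_not_subset_of_tip (hC : Whitehead.IsCut C m) {f : S.E} (hf : S.label f = m.1) :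
    ¬ S.letters (S.tip (f, !m.2)) ⊆ C := fun h => hC.2 (h (inv_mem_letters hf))

theorem survives_primed (hS : S.Folded) (hC : Whitehead.IsCut C m) {v : S.V}
    (hv : S.Meets C v) : S.Survives C m (S.primed C m v) := by
  cases hu : S.primed C m v with
  | inl u =>
    obtain ⟨f, hf, -, rfl⟩ := exists_of_primed_eq_inl hS hv hu
    exact letters_not_subset_of_tip hC hf
  | inr u => trivial

theorem survives_attach (hS : S.Folded) (hC : Whitehead.IsCut C m) (a : S.E × Bool) :
    S.Survives C m (S.attach C m a) := by
  by_cases h : (S.label a.1, a.2) ∈ C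
  · rw [attach_of_mem h]
    exact survives_primed hS hC (meets_tip h)
  · rw [attach_of_notMem h]
    exact fun h' => h (h' (S.mem_letters a.1 a.2))

theorem survives_edge_inl (hS : S.Folded) (hC : Whitehead.IsCut C m)
    (f : {e // S.label e ≠ m.1}) : S.Survives C m ((S.whitehead C m).src (.inl f)) ∧
      S.Survives C m ((S.whitehead C m).tgt (.inl f)) :=
  ⟨survives_attach hS hC _, survives_attach hS hC _⟩

theorem survives_edge_inr_iff (hS : S.Folded) (hC : Whitehead.IsCut C m)
    (v : {v // S.Meets C v}) : (S.Survives C m ((S.whitehead C m).src (.inr v)) ∧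
      S.Survives C m ((S.whitehead C m).tgt (.inr v))) ↔ ¬ S.letters v.1 ⊆ C := by
  have h := survives_primed hS hC v.2
  rcases m with ⟨x, _ | _⟩
  · exact and_iff_left h
  · exact and_iff_right h

theorem folded_whitehead (hS : S.Folded) : (S.whitehead C m).Folded := by
  refine folded_of_eq fun e f b hl ht => ?_
  rw [whitehead_tip, whitehead_tip] at ht
  rcases e with e | v <;> rcases f with f | w
  · replace hl : S.label e.1 = S.label f.1 := hl
    rw [whiteheadTip_inl, whiteheadTip_inl] at ht
    have hef : S.tip (e.1, b) = S.tip (f.1, b) := by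
      by_cases h : (S.label e.1, b) ∈ C
      · have h' : (S.label f.1, b) ∈ C := hl ▸ h
        rw [attach_of_mem h, attach_of_mem h'] at ht
        exact primed_injOn hS (meets_tip h) (meets_tip h') ht
      · have h' : (S.label f.1, b) ∉ C := hl ▸ h
        rw [attach_of_notMem h, attach_of_notMem h'] at ht
        exact Sum.inl_injective ht
    rw [Subtype.ext (hS.eq_of_tip hl hef)]
  · exact absurd hl e.2
  · exact absurd hl.symm f.2
  · have hvw : v.1 = w.1 := by
      by_cases hb : b = m.2
      · subst hb
        rw [whiteheadTip_inr_self, whiteheadTip_inr_self] at ht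
        exact Sum.inl_injective ht
      · obtain rfl : b = !m.2 := by cases b <;> cases h : m.2 <;> simp_all
        rw [whiteheadTip_inr_not, whiteheadTip_inr_not] at ht
        exact primed_injOn hS v.2 w.2 ht
    rw [Subtype.ext hvw]

theorem fst_ne_of_mem (hC : Whitehead.IsCut C m) {y : X × Bool} (hy : y ∈ C) (hne : y ≠ m) :
    y.1 ≠ m.1 := by
  intro h
  have hb : y.2 = !m.2 := by
    have : y.2 ≠ m.2 := fun h' => hne (Prod.ext h h')
    cases h1 : y.2 <;> cases h2 : m.2 <;> simp_all
  exact hC.2 ((Prod.ext h hb : y = (m.1, !m.2)) ▸ hy)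

/-- An end `c` outside `C` leaves a trace at the same vertex of the core. The last two clauses keep
traces of different ends distinct from each other and from the terminal end of the new `m`-edge. -/
theorem exists_tip_of_notMem (hS : S.Folded) (hC : Whitehead.IsCut C m)
    (hdeg : ∀ v, ∃ a b, a ≠ b ∧ S.tip a = v ∧ S.tip b = v) {c : S.E × Bool}
    (hc : S.signedLabel c ∉ C) :
    ∃ a, (S.whitehead C m).tip a = .inl (S.tip c) ∧
      (S.Survives C m ((S.whitehead C m).src a.1) ∧
        S.Survives C m ((S.whitehead C m).tgt a.1)) ∧
      (S.whitehead C m).signedLabel a ≠ m ∧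
      ((S.whitehead C m).signedLabel a = S.signedLabel c ∨
        S.signedLabel c = (m.1, !m.2) ∧ (S.whitehead C m).signedLabel a ∈ C) := by
  obtain ⟨f, b⟩ := c
  by_cases hf : S.label f = m.1
  · obtain rfl : b = !m.2 := by
      have : b ≠ m.2 := by
        rintro rfl
        exact hc ((Prod.ext hf rfl : (S.label f, m.2) = m) ▸ hC.1)
      cases b <;> cases h : m.2 <;> simp_all
    have hm := mem_letters_of_label hf
    -- If the far end of `f` becomes a leaf, then `f` is lost. A second end `g` there has its label
    -- in `C`, so it was moved to the origin of `f` and replaces it.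
    by_cases hsub : S.letters (S.tip (f, m.2)) ⊆ C
    · obtain ⟨g, b', hne, hg⟩ : ∃ g b', (g, b') ≠ (f, m.2) ∧ S.tip (g, b') = S.tip (f, m.2) := by
        obtain ⟨a, b, hab, ha, hb⟩ := hdeg (S.tip (f, m.2))
        by_cases h : a = (f, m.2)
        · exact ⟨b.1, b.2, fun h' => hab (h.trans h'.symm), hb⟩
        · exact ⟨a.1, a.2, h, ha⟩
      have hgC : (S.label g, b') ∈ C := hsub (hg ▸ S.mem_letters g b')
      have hgm : (S.label g, b') ≠ m := by
        rintro rfl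
        exact hne (by rw [hS.eq_of_tip hf.symm hg])
      have hg1 := fst_ne_of_mem hC hgC hgm
      refine ⟨(.inl ⟨g, hg1⟩, b'), ?_, survives_edge_inl hS hC _, hgm, .inr ⟨?_, hgC⟩⟩
      · rw [whitehead_tip, whiteheadTip_inl, attach_of_mem hgC, hg, primed_tip hS hf]
      · exact Prod.ext hf rfl
    · refine ⟨(.inr ⟨S.tip (f, m.2), m, hm, hC.1⟩, !m.2), ?_,
        (survives_edge_inr_iff hS hC _).2 hsub, ?_, .inl ?_⟩
      · rw [whitehead_tip, whiteheadTip_inr_not, primed_tip hS hf]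
      · exact fun h => Bool.not_ne_self m.2 (congrArg Prod.snd h)
      · exact Prod.ext hf.symm rfl
  · refine ⟨(.inl ⟨f, hf⟩, b), ?_, survives_edge_inl hS hC _, ?_, .inl rfl⟩
    · rw [whitehead_tip, whiteheadTip_inl, attach_of_notMem hc]
    · exact fun h => hf (congrArg Prod.fst h)

theorem exists_tip_of_mem (hC : Whitehead.IsCut C m) {c : S.E × Bool}
    (hc : S.signedLabel c ∈ C) (hm : m ∉ S.letters (S.tip c)) :
    ∃ h : S.label c.1 ≠ m.1, (S.whitehead C m).tip (.inl ⟨c.1, h⟩, c.2) =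
        .inr ⟨S.tip c, meets_tip hc, hm⟩ := by
  have hne : S.signedLabel c ≠ m := by
    rintro rfl
    exact hm (S.mem_letters c.1 c.2)
  refine ⟨fst_ne_of_mem hC hc hne, ?_⟩
  rw [whitehead_tip, whiteheadTip_inl, attach_of_mem hc, primed_of_notMem (meets_tip hc) hm]

theorem isCore_whitehead (hS : S.Folded) (hC : Whitehead.IsCut C m)
    (hdeg : ∀ v, ∃ a b, a ≠ b ∧ S.tip a = v ∧ S.tip b = v) :
    (S.whitehead C m).IsCore (S.Survives C m) := by
  constructor
  · rintro (v | ⟨v, hv, hm⟩) hp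
    · have hp' : ¬ S.letters v ⊆ C := hp
      obtain ⟨_, ⟨c, hcv, rfl⟩, hc⟩ := Set.not_subset.1 hp'
      obtain rfl : S.tip c = v := hcv
      obtain ⟨a, ha, has, ham, hal⟩ := exists_tip_of_notMem hS hC hdeg hc
      obtain ⟨c', hcc', hc'⟩ : ∃ c', c' ≠ c ∧ S.tip c' = S.tip c := by
        obtain ⟨a, b, hab, ha, hb⟩ := hdeg (S.tip c)
        by_cases h : a = c
        · exact ⟨b, fun h' => hab (h.trans h'.symm), hb⟩
        · exact ⟨a, h, ha⟩
      -- The second end is that of the new `m`-edge if `c'` is moved away, and otherwise the trace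
      -- of `c'`.
      by_cases hc'C : S.signedLabel c' ∈ C
      · refine ⟨a, (.inr ⟨S.tip c, hc' ▸ meets_tip hc'C⟩, m.2), ?_, ⟨ha, has⟩, ?_,
          (survives_edge_inr_iff hS hC _).2 hp'⟩
        · rintro rfl
          exact ham rfl
        · rw [whitehead_tip, whiteheadTip_inr_self]
      · obtain ⟨a', ha', has', ham', hal'⟩ := exists_tip_of_notMem hS hC hdeg hc'C
        refine ⟨a, a', ?_, ⟨ha, has⟩, ha'.trans (by rw [hc']), has'⟩
        rintro rfl
        have hne : S.signedLabel c' ≠ S.signedLabel c := fun h =>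
          hcc' (hS (S.tip c) hc' rfl h)
        rcases hal with h1 | ⟨h1, h1'⟩ <;> rcases hal' with h2 | ⟨h2, h2'⟩
        · exact hne (h2.symm.trans h1)
        · exact hc (h1 ▸ h2')
        · exact hc'C (h2 ▸ h1')
        · exact hne (h2.trans h1.symm)
    -- A new vertex receives two moved ends, or one moved end and the surviving `m`-edge to `v`.
    · by_cases hsub : S.letters v ⊆ C
      · obtain ⟨a, b, hab, ha, hb⟩ := hdeg v
        have haC : S.signedLabel a ∈ C := hsub ⟨a, ha, rfl⟩
        have hbC : S.signedLabel b ∈ C := hsub ⟨b, hb, rfl⟩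
        obtain ⟨h1, h1'⟩ := exists_tip_of_mem hC haC (ha ▸ hm)
        obtain ⟨h2, h2'⟩ := exists_tip_of_mem hC hbC (hb ▸ hm)
        refine ⟨_, _, ?_, ⟨h1'.trans (by simp only [ha]), survives_edge_inl hS hC _⟩,
          h2'.trans (by simp only [hb]), survives_edge_inl hS hC _⟩
        intro h
        obtain ⟨h3, h4⟩ := Prod.mk.inj h
        exact hab (Prod.ext (Subtype.mk.inj (Sum.inl_injective h3)) h4)
      · obtain ⟨_, ⟨a, ha, rfl⟩, haC⟩ := id hv
        obtain ⟨h1, h1'⟩ := exists_tip_of_mem hC haC ((show S.tip a = v from ha) ▸ hm)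
        refine ⟨_, (.inr ⟨v, hv⟩, !m.2), ?_,
          ⟨h1'.trans (by simp only [show S.tip a = v from ha]), survives_edge_inl hS hC _⟩, ?_,
          (survives_edge_inr_iff hS hC _).2 hsub⟩
        · intro h
          cases (Prod.mk.inj h).1
        · rw [whitehead_tip, whiteheadTip_inr_not, primed_of_notMem hv hm]
  · rintro (v | v) hp
    · have hsub : S.letters v ⊆ C := not_not.1 hp
      have hv : S.Meets C v := by
        obtain ⟨a, -, -, ha, -⟩ := hdeg v
        exact ⟨_, ⟨a, ha, rfl⟩, hsub ⟨a, ha, rfl⟩⟩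
      -- All ends at `v` are moved away, and none is moved to `v`, since no `m`-edge starts there;
      -- only the new `m`-edge remains.
      have hprimed : ∀ w, S.Meets C w → S.primed C m w ≠ .inl v := by
        intro w hw h
        obtain ⟨f, hf, -, rfl⟩ := exists_of_primed_eq_inl hS hw h
        exact letters_not_subset_of_tip hC hf hsub
      refine ⟨(.inr ⟨v, hv⟩, m.2), ?_, ?_, ?_⟩
      · rw [whitehead_tip, whiteheadTip_inr_self]
      · rintro ⟨f | w, b⟩ h
        · rw [whitehead_tip, whiteheadTip_inl] at h
          by_cases hfC : (S.label f.1, b) ∈ C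
          · rw [attach_of_mem hfC] at h
            exact absurd h (hprimed _ (meets_tip hfC))
          · rw [attach_of_notMem hfC] at h
            exact absurd (hsub (Sum.inl_injective h ▸ S.mem_letters f.1 b)) hfC
        · rw [whitehead_tip] at h
          by_cases hb : b = m.2
          · subst hb
            rw [whiteheadTip_inr_self] at h
            exact congrArg (fun x => (Sum.inr x, m.2)) (Subtype.ext (Sum.inl_injective h))
          · obtain rfl : b = !m.2 := by cases b <;> cases h : m.2 <;> simp_all
            rw [whiteheadTip_inr_not] at h
            exact absurd h (hprimed _ w.2)
      · rw [whitehead_tip, whiteheadTip_inr_not]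
        exact survives_primed hS hC hv
    · exact absurd trivial hp

end Whitehead

/-! ### Folding a subdivision -/

section Subdivide

variable {S T : XDigraph.{u, v} X} {W : X → List (X × Bool)}

theorem FoldRel.of_tip {e f : S.E} (hl : S.label e = S.label f) {b : Bool}
    (h : S.FoldRel (S.tip (e, b)) (S.tip (f, b))) :
    S.FoldRel (S.tip (e, !b)) (S.tip (f, !b)) := by
  cases b
  · exact .coinitial hl h
  · exact .coterminal hl h

/-- Position 0 is always the source, so an empty word would give the wrong end. -/
theorem pathVertex_length (e : S.E) (h : W (S.label e) ≠ []) :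
    S.pathVertex W e (W (S.label e)).length = .inl (S.tgt e) := by
  have := List.length_pos_iff.2 h
  rw [pathVertex, if_neg (by omega), dif_neg (by omega)]

theorem pathVertex_succ (e : S.E) (j : Fin ((W (S.label e)).length - 1)) :
    S.pathVertex W e (j + 1) = .inr ⟨e, j⟩ := by
  rw [pathVertex, if_neg (by omega), dif_pos (show j.1 + 1 - 1 < _ from j.2)]
  rfl

theorem subdivide_tip (e : S.E) (i : Fin (W (S.label e)).length) :
    (S.subdivide W).tip (⟨e, i⟩, ((W (S.label e)).get i).2) = S.pathVertex W e (i + 1) ∧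
    (S.subdivide W).tip (⟨e, i⟩, !((W (S.label e)).get i).2) = S.pathVertex W e i := by
  have hsrc : (S.subdivide W).src ⟨e, i⟩ = if ((W (S.label e)).get i).2 = true then
    S.pathVertex W e i else S.pathVertex W e (i + 1) := rfl
  have htgt : (S.subdivide W).tgt ⟨e, i⟩ = if ((W (S.label e)).get i).2 = true then
    S.pathVertex W e (i + 1) else S.pathVertex W e i := rfl
  cases h : ((W (S.label e)).get i).2
  · rw [h] at hsrc htgt
    exact ⟨hsrc, htgt⟩
  · rw [h] at hsrc htgt
    exact ⟨htgt, hsrc⟩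

theorem exists_subdivide_edge {e : S.E} {i : ℕ} {y : X × Bool}
    (h : (W (S.label e))[i]? = some y) : ∃ g : (S.subdivide W).E, (S.subdivide W).label g = y.1 ∧
      (S.subdivide W).tip (g, y.2) = S.pathVertex W e (i + 1) ∧
      (S.subdivide W).tip (g, !y.2) = S.pathVertex W e i := by
  obtain ⟨hi, rfl⟩ := List.getElem?_eq_some_iff.1 h
  exact ⟨⟨e, ⟨i, hi⟩⟩, rfl, subdivide_tip e ⟨i, hi⟩⟩

/-- The map on the vertices of a subdivision given by a map `fV` on the vertices and the positions
`pos e i` of the `i`-th vertex of the path that replaces `e`. -/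
def subdivideMap (fV : S.V → T.V) (pos : S.E → ℕ → T.V) : (S.subdivide W).V → T.V :=
  Sum.elim fV fun z => pos z.1 (z.2 + 1)

theorem subdivideMap_pathVertex {fV : S.V → T.V} {pos : S.E → ℕ → T.V}
    (h0 : ∀ e, pos e 0 = fV (S.src e))
    (hn : ∀ e, pos e (W (S.label e)).length = fV (S.tgt e)) {e : S.E} {i : ℕ}
    (hi : i ≤ (W (S.label e)).length) :
    subdivideMap fV pos (S.pathVertex W e i) = pos e i := by
  by_cases hi0 : i = 0
  · rw [hi0, h0]; rfl
  · by_cases h : i - 1 < (W (S.label e)).length - 1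
    · obtain ⟨j, rfl⟩ := Nat.exists_eq_succ_of_ne_zero hi0
      rw [show S.pathVertex W e j.succ = _ from pathVertex_succ e ⟨j, h⟩]
      rfl
    · have : i = (W (S.label e)).length := by omega
      rw [this, hn, ← this, pathVertex, if_neg hi0, dif_neg h]
      rfl

/-- A morphism out of a subdivision amounts to tracing each word in `T`; foldedness of `T`
determines the edges from their labels and one end. -/
theorem nonempty_iso_fold_subdivide (hT : T.Folded) {fV : S.V → T.V} {pos : S.E → ℕ → T.V}
    (h0 : ∀ e, pos e 0 = fV (S.src e))
    (hn : ∀ e, pos e (W (S.label e)).length = fV (S.tgt e))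
    (hedge : ∀ e i y, (W (S.label e))[i]? = some y →
      ∃ g, T.label g = y.1 ∧ T.tip (g, y.2) = pos e (i + 1) ∧ T.tip (g, !y.2) = pos e i)
    (hV : ∀ t, (∃ v, fV v = t) ∨ ∃ e i, i ≤ (W (S.label e)).length ∧ pos e i = t)
    (hE : ∀ t, ∃ e i y, (W (S.label e))[i]? = some y ∧ T.label t = y.1 ∧
      T.tip (t, !y.2) = pos e i)
    (hker : ∀ a b, subdivideMap fV pos a = subdivideMap fV pos b → (S.subdivide W).FoldRel a b) :
    Nonempty (Iso (S.subdivide W).fold T) := by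
  choose fE hl ht1 ht2 using fun p : (S.subdivide W).E =>
    hedge p.1 p.2 ((W (S.label p.1)).get p.2) (List.getElem?_eq_getElem p.2.2)
  have htip : ∀ p b, T.tip (fE p, b) = subdivideMap fV pos ((S.subdivide W).tip (p, b)) := by
    rintro ⟨e, i⟩ b
    by_cases hb : b = ((W (S.label e)).get i).2
    · subst hb
      exact (ht1 ⟨e, i⟩).trans ((congrArg _ (subdivide_tip e i).1).trans
        (subdivideMap_pathVertex h0 hn i.2)).symm
    · obtain rfl : b = !((W (S.label e)).get i).2 := by
        cases b <;> cases h : ((W (S.label e)).get i).2 <;> simp_all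
      exact (ht2 ⟨e, i⟩).trans ((congrArg _ (subdivide_tip e i).2).trans
        (subdivideMap_pathVertex h0 hn i.2.le)).symm
  refine nonempty_iso_fold hT (subdivideMap fV pos) fE (fun p => htip p false)
    (fun p => htip p true) hl ?_ ?_ hker
  · intro t
    rcases hV t with ⟨v, rfl⟩ | ⟨e, i, hi, rfl⟩
    · exact ⟨.inl v, rfl⟩
    · exact ⟨_, subdivideMap_pathVertex h0 hn hi⟩
  · intro t
    obtain ⟨e, i, y, hy, htl, htt⟩ := hE t
    obtain ⟨hi, rfl⟩ := List.getElem?_eq_some_iff.1 hy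
    exact ⟨⟨e, ⟨i, hi⟩⟩, hT.eq_of_tip ((hl _).trans htl.symm) ((ht2 ⟨e, ⟨i, hi⟩⟩).trans htt.symm)⟩

end Subdivide

/-! ### The words of a Whitehead automorphism -/

section Word

variable (C : Set (X × Bool)) (m : X × Bool)

open Classical in
/-- The reduced word of the image of the letter `x` under the Whitehead automorphism `(C, m)`. -/
noncomputable def whiteheadWord (x : X) : List (X × Bool) :=
  if x = m.1 then [(x, true)]
  else (if (x, false) ∈ C then [(m.1, !m.2)] else []) ++ (x, true) ::
    (if (x, true) ∈ C then [m] else [])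

variable {C m}

theorem whiteheadWord_self : whiteheadWord C m m.1 = [(m.1, true)] := if_pos rfl

/-- No cancellation occurs, as the letter between the multipliers differs from `m.1`. -/
theorem toWord_aut [DecidableEq X] (x : X) :
    (Whitehead.aut C m (FreeGroup.of x)).toWord = whiteheadWord C m x := by
  have h : Whitehead.aut C m (FreeGroup.of x) = Whitehead.value C m (FreeGroup.mk [m]) x := by
    simp [Whitehead.aut]
  rw [h, Whitehead.value, whiteheadWord]
  by_cases hx : x = m.1
  · simp [hx]
  · have hx' : m.1 ≠ x := Ne.symm hx
    obtain ⟨n, b⟩ := m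
    simp only at hx hx'
    by_cases hf : (x, false) ∈ C <;> by_cases ht : (x, true) ∈ C <;>
      simp [hx, hx', hf, ht, FreeGroup.of, FreeGroup.inv_mk, FreeGroup.invRev, FreeGroup.toWord_mk,
        FreeGroup.reduce]

end Word

/-! ### Identification of the folded subdivision with `whitehead`. -/

section Whitehead

variable (S : XDigraph.{u, v} X) (C : Set (X × Bool)) (m : X × Bool)

open Classical in
/-- The vertices of `S.whitehead C m` on the path that replaces the edge `e`. -/
noncomputable def pathPos (e : S.E) (i : ℕ) : S.V ⊕ {v // S.Meets C v ∧ m ∉ S.letters v} :=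
  if i = 0 then .inl (S.src e)
  else if S.label e = m.1 then .inl (S.tgt e)
  else if (S.label e, false) ∈ C then
    if i = 1 then S.attach C m (e, false)
    else if i = 2 then S.attach C m (e, true) else .inl (S.tgt e)
  else if i = 1 then S.attach C m (e, true) else .inl (S.tgt e)

variable {S C m}

theorem pathPos_length (e : S.E) :
    S.pathPos C m e (whiteheadWord C m (S.label e)).length = .inl (S.tgt e) := by
  by_cases hm : S.label e = m.1
  · simp [hm, whiteheadWord, pathPos]
  · by_cases hf : (S.label e, false) ∈ C <;> by_cases ht : (S.label e, true) ∈ C <;>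
      simp [hm, hf, ht, whiteheadWord, pathPos, attach]

theorem whitehead_tip_multiplier (hS : S.Folded) {e : S.E} (he : S.label e = m.1)
    (h : S.Meets C (S.tip (e, m.2))) (b : Bool) :
    (S.whitehead C m).tip (.inr ⟨S.tip (e, m.2), h⟩, b) = .inl (S.tip (e, b)) := by
  rw [whitehead_tip]
  by_cases hb : b = m.2
  · subst hb
    rw [whiteheadTip_inr_self]
  · obtain rfl : b = !m.2 := by cases b <;> cases h : m.2 <;> simp_all
    rw [whiteheadTip_inr_not, primed_tip hS he]

theorem meets_of_label (hC : Whitehead.IsCut C m) {e : S.E} (he : S.label e = m.1) :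
    S.Meets C (S.tip (e, m.2)) := ⟨m, mem_letters_of_label he, hC.1⟩

theorem exists_whitehead_edge (hS : S.Folded) (hC : Whitehead.IsCut C m) (e : S.E) (i : ℕ)
    (y : X × Bool) (h : (whiteheadWord C m (S.label e))[i]? = some y) :
    ∃ g, (S.whitehead C m).label g = y.1 ∧
      (S.whitehead C m).tip (g, y.2) = S.pathPos C m e (i + 1) ∧
      (S.whitehead C m).tip (g, !y.2) = S.pathPos C m e i := by
  by_cases hm : S.label e = m.1
  · rw [hm, whiteheadWord_self] at h
    obtain ⟨rfl, rfl⟩ : i = 0 ∧ (m.1, true) = y := by rcases i with _ | i <;> simp_all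
    refine ⟨.inr ⟨_, meets_of_label hC hm⟩, rfl, ?_, ?_⟩
    · rw [whitehead_tip_multiplier hS hm]
      simp [pathPos, hm]
    · rw [whitehead_tip_multiplier hS hm]
      simp [pathPos]
  · have h1 : ∀ hf : (S.label e, false) ∈ C,
        (S.whitehead C m).tip (.inr ⟨S.src e, meets_tip hf⟩, m.2) = .inl (S.src e) ∧
        (S.whitehead C m).tip (.inr ⟨S.src e, meets_tip hf⟩, !m.2) = S.attach C m (e, false) := by
      intro hf
      rw [attach_of_mem hf, whitehead_tip, whitehead_tip]
      exact ⟨whiteheadTip_inr_self _, whiteheadTip_inr_not _⟩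
    have h2 : ∀ b, (S.whitehead C m).tip (.inl ⟨e, hm⟩, b) = S.attach C m (e, b) := by
      intro b
      rw [whitehead_tip, whiteheadTip_inl]
    have h3 : ∀ ht : (S.label e, true) ∈ C,
        (S.whitehead C m).tip (.inr ⟨S.tgt e, meets_tip ht⟩, m.2) = .inl (S.tgt e) ∧
        (S.whitehead C m).tip (.inr ⟨S.tgt e, meets_tip ht⟩, !m.2) = S.attach C m (e, true) := by
      intro ht
      rw [attach_of_mem ht, whitehead_tip, whitehead_tip]
      exact ⟨whiteheadTip_inr_self _, whiteheadTip_inr_not _⟩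
    by_cases hf : (S.label e, false) ∈ C <;> by_cases ht : (S.label e, true) ∈ C <;>
      simp only [whiteheadWord, hm, hf, ht, if_true, if_false, List.nil_append,
        List.cons_append] at h <;> rcases i with _ | _ | _ | i <;>
      simp only [List.getElem?_cons_zero, List.getElem?_cons_succ, List.getElem?_nil,
        Option.some.injEq, reduceCtorEq, zero_add] at h <;> subst h
    · exact ⟨_, rfl, by simpa [pathPos, hm, hf] using (h1 hf).2,
        by simpa [pathPos] using (h1 hf).1⟩
    · exact ⟨_, rfl, by simpa [pathPos, hm, hf] using h2 true,
        by simpa [pathPos, hm, hf] using h2 false⟩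
    · exact ⟨_, rfl, by simpa [pathPos, hm, hf] using (h3 ht).1,
        by simpa [pathPos, hm, hf] using (h3 ht).2⟩
    · exact ⟨_, rfl, by simpa [pathPos, hm, hf] using (h1 hf).2,
        by simpa [pathPos] using (h1 hf).1⟩
    · exact ⟨_, rfl, by simpa [pathPos, hm, hf] using h2 true,
        by simpa [pathPos, hm, hf] using h2 false⟩
    · exact ⟨_, rfl, by simpa [pathPos, hm, hf] using h2 true,
        by simpa [pathPos, hm, hf, attach] using h2 false⟩
    · exact ⟨_, rfl, by simpa [pathPos, hm, hf] using (h3 ht).1,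
        by simpa [pathPos, hm, hf] using (h3 ht).2⟩
    · exact ⟨_, rfl, by simpa [pathPos, hm, hf] using h2 true,
        by simpa [pathPos, hm, hf, attach] using h2 false⟩

/-- Every end of an edge that is not labelled by the multiplier occurs as the end of the
corresponding edge of `S.whitehead C m`. -/
theorem exists_pathPos_eq_attach {a : S.E × Bool} (ha : S.label a.1 ≠ m.1) :
    ∃ i ≤ (whiteheadWord C m (S.label a.1)).length, S.pathPos C m a.1 i = S.attach C m a := by
  obtain ⟨e, b⟩ := a
  simp only at ha
  by_cases hf : (S.label e, false) ∈ C <;> cases b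
  · exact ⟨1, by simp [whiteheadWord, ha, hf], by simp [pathPos, ha, hf]⟩
  · exact ⟨2, by simp [whiteheadWord, ha, hf], by simp [pathPos, ha, hf]⟩
  · exact ⟨0, by simp, by simp [pathPos, hf, attach]⟩
  · exact ⟨1, by simp [whiteheadWord, ha, hf], by simp [pathPos, ha, hf]⟩

/-- Each interior vertex of a path is the origin of an `m`-edge to an original vertex `v`. This is
what folding uses to identify interior vertices. -/
theorem exists_subdivide_multiplier_edge (z : Σ e : S.E,
    Fin ((whiteheadWord C m (S.label e)).length - 1)) :
    ∃ v, S.Meets C v ∧ S.pathPos C m z.1 (z.2 + 1) = S.primed C m v ∧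
      ∃ g, (S.subdivide (whiteheadWord C m)).label g = m.1 ∧
        (S.subdivide (whiteheadWord C m)).tip (g, m.2) = .inl v ∧
        (S.subdivide (whiteheadWord C m)).tip (g, !m.2) = .inr z := by
  obtain ⟨e, j⟩ := z
  have hj := j.2
  have hpos := pathVertex_succ e j
  have hlen := pathVertex_length (W := whiteheadWord C m) e
  simp only
  by_cases hm : S.label e = m.1
  · have : (whiteheadWord C m (S.label e)).length = 1 := by rw [hm, whiteheadWord_self]; rfl
    omega
  · by_cases hf1 : (S.label e, false) ∈ C ∧ j.1 = 0
    · obtain ⟨hf, hj0⟩ := hf1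
      refine ⟨S.src e, meets_tip hf, ?_, ?_⟩
      · simp [hj0, pathPos, hm, hf, attach_of_mem]
      · obtain ⟨g, hg, hg1, hg2⟩ := exists_subdivide_edge (S := S) (W := whiteheadWord C m)
          (e := e) (i := 0) (y := (m.1, !m.2)) (by simp [whiteheadWord, hm, hf])
        refine ⟨g, hg, ?_, ?_⟩
        · rw [Bool.not_not] at hg2
          exact hg2
        · rw [← hpos, hj0]
          exact hg1
    -- Otherwise `j` is the last interior position, and the word ends with the letter `m`.
    · obtain ⟨ht, hw, hj'⟩ : (S.label e, true) ∈ C ∧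
          (whiteheadWord C m (S.label e))[j.1 + 1]? = some m ∧
          (whiteheadWord C m (S.label e)).length = j.1 + 1 + 1 ∧
          S.pathPos C m e (j.1 + 1) = S.attach C m (e, true) := by
        by_cases hf : (S.label e, false) ∈ C <;> by_cases ht : (S.label e, true) ∈ C <;>
          simp [whiteheadWord, hm, hf, ht] at hj hf1 ⊢
        · obtain hj1 : j.1 = 1 := by omega
          simp [hj1, pathPos, hm, hf]
        · omega
        · simp [hj, pathPos, hm, hf]
      refine ⟨S.tgt e, meets_tip ht, hj'.2.trans (attach_of_mem ht), ?_⟩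
      obtain ⟨g, hg, hg1, hg2⟩ := exists_subdivide_edge hw
      refine ⟨g, hg, ?_, hg2.trans hpos⟩
      rw [hg1, ← hj'.1]
      exact hlen (List.ne_nil_of_length_pos (by omega))

/-- Interior vertices with equal images start `m`-edges to the same `v`, by `primed_injOn`, so those
edges fold together. If the image is an old vertex, the `m`-edge of `S` from it to `v` plays the
part of the second edge. -/
theorem foldRel_of_subdivideMap_eq (hS : S.Folded)
    (a b : (S.subdivide (whiteheadWord C m)).V)
    (h : subdivideMap (T := S.whitehead C m) (fun v => .inl v) (S.pathPos C m) a =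
      subdivideMap (T := S.whitehead C m) (fun v => .inl v) (S.pathPos C m) b) :
    (S.subdivide (whiteheadWord C m)).FoldRel a b := by
  have key : ∀ u z, S.pathPos C m z.1 (z.2 + 1) = .inl u →
      (S.subdivide (whiteheadWord C m)).FoldRel (.inr z) (.inl u) := by
    intro u z hz
    obtain ⟨v, hv, hvz, g, hg, hg1, hg2⟩ := exists_subdivide_multiplier_edge z
    obtain ⟨f, hf, rfl, rfl⟩ := exists_of_primed_eq_inl hS hv (hvz.symm.trans hz)
    obtain ⟨k, hk, hk1, hk2⟩ : ∃ k, (S.subdivide (whiteheadWord C m)).label k = m.1 ∧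
        (S.subdivide (whiteheadWord C m)).tip (k, true) = .inl (S.tgt f) ∧
        (S.subdivide (whiteheadWord C m)).tip (k, false) = .inl (S.src f) := by
      obtain ⟨k, hk, hk1, hk2⟩ := exists_subdivide_edge (S := S) (W := whiteheadWord C m)
        (e := f) (i := 0) (y := (m.1, true)) (by simp [whiteheadWord, hf])
      refine ⟨k, hk, hk1.trans ?_, hk2⟩
      simp [pathVertex, whiteheadWord, hf]
      rfl
    have hk3 : ∀ b, (S.subdivide (whiteheadWord C m)).tip (k, b) = .inl (S.tip (f, b)) := by
      rintro (_ | _)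
      exacts [hk2, hk1]
    rw [← hg2, ← hk3]
    refine FoldRel.of_tip (hg.trans hk.symm) ?_
    rw [hg1, hk3]
    exact .refl _
  rcases a with a | z <;> rcases b with b | w
  · rw [show a = b from Sum.inl_injective h]
    exact .refl _
  · exact (key a w h.symm).symm
  · exact key b z h
  · obtain ⟨v, hv, hvz, g, hg, hg1, hg2⟩ := exists_subdivide_multiplier_edge z
    obtain ⟨v', hv', hvw, k, hk, hk1, hk2⟩ := exists_subdivide_multiplier_edge w
    obtain rfl := primed_injOn hS hv hv' (hvz.symm.trans (Eq.trans h hvw))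
    rw [← hg2, ← hk2]
    refine FoldRel.of_tip (hg.trans hk.symm) ?_
    rw [hg1, hk1]
    exact .refl _

theorem nonempty_iso_fold_whitehead (hS : S.Folded) (hC : Whitehead.IsCut C m) :
    Nonempty (Iso (S.subdivide (whiteheadWord C m)).fold (S.whitehead C m)) := by
  refine nonempty_iso_fold_subdivide (folded_whitehead hS) (fV := fun v => .inl v)
    (pos := S.pathPos C m) (fun e => if_pos rfl) pathPos_length (exists_whitehead_edge hS hC)
    ?_ ?_ (foldRel_of_subdivideMap_eq hS)
  · rintro (v | ⟨v, hv, hm⟩)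
    · exact .inl ⟨v, rfl⟩
    · right
      obtain ⟨_, ⟨c, hcv, rfl⟩, hc⟩ := id hv
      obtain rfl : S.tip c = v := hcv
      obtain ⟨h, -⟩ := exists_tip_of_mem hC hc hm
      obtain ⟨i, hi, hpos⟩ := exists_pathPos_eq_attach (C := C) h
      refine ⟨c.1, i, hi, hpos.trans ?_⟩
      rw [attach_of_mem hc, primed_of_notMem hv hm]
  · rintro (⟨e, he⟩ | ⟨v, hv⟩)
    · have htip : (S.whitehead C m).tip (.inl ⟨e, he⟩, false) = S.attach C m (e, false) := by
        rw [whitehead_tip, whiteheadTip_inl]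
      by_cases hf : (S.label e, false) ∈ C
      · exact ⟨e, 1, (S.label e, true), by simp [whiteheadWord, he, hf], rfl,
          by simpa [pathPos, he, hf] using htip⟩
      · exact ⟨e, 0, (S.label e, true), by simp [whiteheadWord, he, hf], rfl,
          by simpa [pathPos, attach, hf] using htip⟩
    · obtain ⟨_, ⟨⟨e, b⟩, hcv, rfl⟩, hc⟩ := id hv
      obtain rfl : S.tip (e, b) = v := hcv
      have hc' : (S.label e, b) ∈ C := hc
      by_cases he : S.label e = m.1
      · obtain rfl : b = m.2 := by
          by_contra hb
          have : b = !m.2 := by cases b <;> cases h : m.2 <;> simp_all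
          exact hC.2 (he ▸ this ▸ hc')
        refine ⟨e, 0, (m.1, true), by simp [whiteheadWord, he], rfl, ?_⟩
        exact (whitehead_tip_multiplier hS he hv false).trans (if_pos rfl).symm
      · cases b
        · refine ⟨e, 0, (m.1, !m.2), by simp [whiteheadWord, he, hc'], rfl, ?_⟩
          rw [Bool.not_not, whitehead_tip, whiteheadTip_inr_self]
          exact (if_pos rfl).symm
        · have htip : (S.whitehead C m).tip (.inr ⟨S.tip (e, true), hv⟩, !m.2) =
              S.attach C m (e, true) := by
            rw [whitehead_tip, whiteheadTip_inr_not, attach_of_mem hc']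
          by_cases hf : (S.label e, false) ∈ C
          · exact ⟨e, 2, m, by simp [whiteheadWord, he, hf, hc'], rfl,
              by simpa [pathPos, he, hf] using htip⟩
          · exact ⟨e, 1, m, by simp [whiteheadWord, he, hf, hc'], rfl,
              by simpa [pathPos, he, hf] using htip⟩

end Whitehead

end XDigraph

/-- Within `s`, both sides equal |s| + |M| − |B|; the check is pointwise. -/
theorem Nat.card_subtype_inclusion_exclusion {α : Type*} [Finite α] {s M B N : α → Prop}
    (hB : ∀ a, B a → M a) (hN : ∀ a, N a → M a) :
    Nat.card {a // M a ∧ ¬ B a ∧ s a} + Nat.card {a // s a} =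
      Nat.card {a // ¬ B a ∧ s a} + Nat.card {a // M a ∧ ¬ N a ∧ s a} +
        Nat.card {a // N a ∧ s a} := by
  classical
  have := Fintype.ofFinite α
  simp only [Nat.card_eq_fintype_card, Fintype.card_subtype, Finset.card_filter,
    ← Finset.sum_add_distrib]
  refine Finset.sum_congr rfl fun a _ => ?_
  have := hB a
  have := hN a
  by_cases s a <;> by_cases M a <;> by_cases B a <;> by_cases N a <;> simp_all

namespace XDigraph

variable {X : Type u}

theorem CyclicallyReduced.exists_tip_ne {S : XDigraph.{u, v} X} (hS : S.CyclicallyReduced)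
    (hc : S.Connected) (e : S.E) (v : S.V) : ∃ a b, a ≠ b ∧ S.tip a = v ∧ S.tip b = v := by
  obtain ⟨a, ha⟩ := hc.exists_tip e v
  by_contra! h
  exact hS v ⟨a, ha, fun b hb => by_contra fun hab => h b a hab hb ha⟩

theorem Folded.induce {S : XDigraph.{u, v} X} (hS : S.Folded) (p : S.V → Prop) :
    (S.induce p).Folded := by
  refine folded_of_eq fun e f b hl ht => Subtype.ext (hS.eq_of_tip (b := b) hl ?_)
  cases b <;> exact congrArg Subtype.val ht

/-! ### Connectivity, counts and Property (L) for the core. -/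

section Whitehead

variable {S : XDigraph.{u, v} X} {C : Set (X × Bool)} {m : X × Bool}

/-- The digraph obtained from `S.whitehead C m` by deleting its leaves. -/
noncomputable abbrev whiteheadCore (S : XDigraph.{u, v} X) (C : Set (X × Bool)) (m : X × Bool) :
    XDigraph.{u, v} X :=
  (S.whitehead C m).induce (S.Survives C m)

/-- The vertex of `S` from which a vertex of `S.whitehead C m` arises. -/
def base : S.V ⊕ {v // S.Meets C v ∧ m ∉ S.letters v} → S.V := Sum.elim id Subtype.val

/-- Passing to `primed` either follows an `m`-edge, which stays on one side, or creates a vertex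
based at `v`. -/
theorem side_base_primed (hS : S.Folded) {side : S.V → Prop}
    (hm : ∀ f, S.label f = m.1 → (side (S.src f) ↔ side (S.tgt f))) {v : S.V}
    (hv : S.Meets C v) : side (base (S.primed C m v)) ↔ side v := by
  by_cases h : m ∈ S.letters v
  · obtain ⟨f, hf, rfl⟩ := exists_of_mem_letters h
    rw [primed_tip hS hf]
    have := hm f hf
    cases m.2
    · exact this.symm
    · exact this
  · rw [primed_of_notMem hv h]
    exact Iff.rfl

theorem side_base_attach (hS : S.Folded) {side : S.V → Prop}
    (hm : ∀ f, S.label f = m.1 → (side (S.src f) ↔ side (S.tgt f))) (a : S.E × Bool) :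
    side (base (S.attach C m a)) ↔ side (S.tip a) := by
  by_cases h : (S.label a.1, a.2) ∈ C
  · rw [attach_of_mem h]
    exact side_base_primed hS hm (meets_tip h)
  · rw [attach_of_notMem h]
    exact Iff.rfl

theorem side_base_tip_inr (hS : S.Folded) {side : S.V → Prop}
    (hm : ∀ f, S.label f = m.1 → (side (S.src f) ↔ side (S.tgt f))) (v : {v // S.Meets C v})
    (b : Bool) : side (base (S.whiteheadTip C m (.inr v, b))) ↔ side v.1 := by
  by_cases hb : b = m.2
  · subst hb
    rw [whiteheadTip_inr_self]
    exact Iff.rfl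
  · obtain rfl : b = !m.2 := by cases b <;> cases h : m.2 <;> simp_all
    rw [whiteheadTip_inr_not]
    exact side_base_primed hS hm v.2

theorem meets_of_subset {v : S.V} (hv : ∃ a, S.tip a = v) (h : S.letters v ⊆ C) :
    S.Meets C v := by
  obtain ⟨a, ha⟩ := hv
  exact ⟨_, ⟨a, ha, rfl⟩, h ⟨a, ha, rfl⟩⟩

/-- A map from `S` to `S.whiteheadCore C m` that respects equivalence relations for which
the ends of every edge labelled by the multiplier are equivalent. -/
theorem exists_retract (hS : S.Folded) (hC : Whitehead.IsCut C m) (hdeg : ∀ v, ∃ a, S.tip a = v)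
    (r : Setoid (S.whiteheadCore C m).V)
    (hr : ∀ v h, r ((S.whiteheadCore C m).src ⟨.inr v, h⟩)
      ((S.whiteheadCore C m).tgt ⟨.inr v, h⟩)) :
    ∃ ρ : S.V → (S.whiteheadCore C m).V,
      (∀ v, (ρ v).1 = .inl v ∨ S.Meets C v ∧ (ρ v).1 = S.primed C m v) ∧
      (∀ z, r z (ρ (base z.1))) ∧
      (∀ f, S.label f = m.1 → r (ρ (S.src f)) (ρ (S.tgt f))) ∧
      ∀ f h, r ((S.whiteheadCore C m).src ⟨.inl f, h⟩) ((S.whiteheadCore C m).tgt ⟨.inl f, h⟩) →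
        r (ρ (S.src f.1)) (ρ (S.tgt f.1)) := by
  -- A deleted leaf goes to its neighbour `primed`; the other vertices stay.
  have hρ : ∀ v, ∃ z : (S.whiteheadCore C m).V,
      (S.letters v ⊆ C → S.Meets C v ∧ z.1 = S.primed C m v) ∧
      (¬ S.letters v ⊆ C → z.1 = .inl v) := by
    intro v
    by_cases h : S.letters v ⊆ C
    · have hv := meets_of_subset (hdeg v) h
      exact ⟨⟨_, survives_primed hS hC hv⟩, fun _ => ⟨hv, rfl⟩, fun h' => absurd h h'⟩
    · exact ⟨⟨.inl v, h⟩, fun h' => absurd h' h, fun _ => rfl⟩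
  choose ρ hρ1 hρ2 using hρ
  have hprimed : ∀ v, S.Meets C v → ∀ z : (S.whiteheadCore C m).V, z.1 = S.primed C m v →
      r z (ρ v) := by
    intro v hv z hz
    by_cases h : S.letters v ⊆ C
    · rw [Subtype.ext (hz.trans (hρ1 v h).2.symm)]
    · have he := (survives_edge_inr_iff hS hC ⟨v, hv⟩).2 h
      have h1 : ∀ b, ((S.whiteheadCore C m).tip (⟨.inr ⟨v, hv⟩, he⟩, b)).1 =
          S.whiteheadTip C m (.inr ⟨v, hv⟩, b) := by
        rintro (_ | _) <;> rfl
      have h2 : (S.whiteheadCore C m).tip (⟨.inr ⟨v, hv⟩, he⟩, m.2) = ρ v :=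
        Subtype.ext ((h1 _).trans ((whiteheadTip_inr_self _).trans (hρ2 v h).symm))
      have h3 : (S.whiteheadCore C m).tip (⟨.inr ⟨v, hv⟩, he⟩, !m.2) = z :=
        Subtype.ext ((h1 _).trans ((whiteheadTip_inr_not _).trans hz.symm))
      have h4 := hr _ he
      rw [← h2, ← h3]
      cases m.2
      · exact r.symm h4
      · exact h4
  have hattach : ∀ a, ∀ z : (S.whiteheadCore C m).V, z.1 = S.attach C m a → r z (ρ (S.tip a)) := by
    intro a z hz
    by_cases h : (S.label a.1, a.2) ∈ C
    · exact hprimed _ (meets_tip h) z (hz.trans (attach_of_mem h))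
    · have h' : ¬ S.letters (S.tip a) ⊆ C := fun h' => h (h' (S.mem_letters a.1 a.2))
      rw [Subtype.ext (hz.trans ((attach_of_notMem h).trans (hρ2 _ h').symm))]
  refine ⟨ρ, fun v => ?_, ?_, ?_, ?_⟩
  · by_cases h : S.letters v ⊆ C
    · exact .inr (hρ1 v h)
    · exact .inl (hρ2 v h)
  · rintro ⟨v | v, hz⟩
    · have : (⟨.inl v, hz⟩ : (S.whiteheadCore C m).V) = ρ v := Subtype.ext (hρ2 v hz).symm
      exact Eq.subst (motive := fun z => r ⟨.inl v, hz⟩ z) this (r.refl _)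
    · exact hprimed v.1 v.2.1 _ (primed_of_notMem v.2.1 v.2.2).symm
  · intro f hf
    have h := hprimed _ (meets_of_label hC hf) (ρ (S.tip (f, !m.2)))
      ((hρ2 _ (letters_not_subset_of_tip hC hf)).trans (primed_tip hS hf).symm)
    cases hm : m.2 <;> rw [hm] at h
    · exact r.symm h
    · exact h
  · intro f h hf
    exact r.trans (r.symm (hattach (f.1, false) _ rfl)) (r.trans hf (hattach (f.1, true) _ rfl))

theorem connected_whiteheadCore (hS : S.Folded) (hC : Whitehead.IsCut C m) (hc : S.Connected)
    (hdeg : ∀ v, ∃ a, S.tip a = v) : (S.whiteheadCore C m).Connected := by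
  obtain ⟨ρ, -, h1, h2, h3⟩ := exists_retract hS hC hdeg (S.whiteheadCore C m).joined
    fun v h => joined_edge _ _
  have key : ∀ {a b}, S.joined a b → (S.whiteheadCore C m).joined (ρ a) (ρ b) := by
    refine joined_map ρ fun f => ?_
    by_cases hf : S.label f = m.1
    · exact h2 f hf
    · exact h3 ⟨f, hf⟩ (survives_edge_inl hS hC _) (joined_edge _ _)
  refine ⟨hc.1.map ρ, fun a b => ?_⟩
  exact Setoid.trans' _ (h1 a) (Setoid.trans' _ (key (hc.2 _ _)) (Setoid.symm' _ (h1 b)))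

theorem isStallingsGraph_whiteheadCore (hS : S.IsStallingsGraph) (hC : Whitehead.IsCut C m)
    (hdeg : ∀ v, ∃ a b, a ≠ b ∧ S.tip a = v ∧ S.tip b = v) :
    (S.whiteheadCore C m).IsStallingsGraph := by
  have := hS.finite_V
  have := hS.finite_E
  have hcon := connected_whiteheadCore hS.folded hC hS.connected
    fun v => (hdeg v).imp fun _ ⟨_, _, h, _⟩ => h
  exact
    { finite_V := inferInstanceAs (Finite {z // S.Survives C m z})
      finite_E := inferInstanceAs (Finite {e : {e // S.label e ≠ m.1} ⊕ {v // S.Meets C v} // _})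
      connected := hcon
      folded := (folded_whitehead hS.folded).induce _
      -- The core has no leaf at all, so any vertex can serve as basepoint.
      core := hcon.1.elim fun b => ⟨b, fun v _ =>
        (isCore_whitehead hS.folded hC hdeg).cyclicallyReduced_induce v⟩ }

theorem card_whiteheadCore_V [Finite S.V] (side : S.V → Prop) :
    Nat.card {z : (S.whiteheadCore C m).V // side (base z.1)} =
      Nat.card {v // ¬ S.letters v ⊆ C ∧ side v} +
        Nat.card {v // S.Meets C v ∧ m ∉ S.letters v ∧ side v} := by
  rw [← Nat.card_sum]
  refine (Nat.card_congr (Equiv.ofBijective (Sum.elim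
    (fun v => ⟨⟨.inl v.1, v.2.1⟩, v.2.2⟩)
    (fun v => ⟨⟨.inr ⟨v.1, v.2.1, v.2.2.1⟩, trivial⟩, v.2.2.2⟩)) ⟨?_, ?_⟩)).symm
  · rintro (⟨v, hv⟩ | ⟨v, hv⟩) (⟨w, hw⟩ | ⟨w, hw⟩) h <;>
      replace h := Subtype.mk.inj (Subtype.mk.inj h)
    · obtain rfl := Sum.inl_injective h; rfl
    · cases h
    · cases h
    · obtain rfl := Subtype.mk.inj (Sum.inr_injective h); rfl
  · rintro ⟨⟨v | v, hz⟩, hs⟩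
    · exact ⟨.inl ⟨v, hz, hs⟩, rfl⟩
    · exact ⟨.inr ⟨v.1, v.2.1, v.2.2, hs⟩, rfl⟩

theorem card_whiteheadCore_E [Finite S.V] [Finite S.E] (hS : S.Folded) (hC : Whitehead.IsCut C m)
    {side : S.V → Prop} (hm : ∀ f, S.label f = m.1 → (side (S.src f) ↔ side (S.tgt f)))
    (e : (S.whiteheadCore C m).E) (e₀ : {e // S.label e ≠ m.1}) (he : e.1 = .inl e₀) :
    Nat.card {f // f ≠ e ∧ side (base ((S.whiteheadCore C m).src f).1)} =
      Nat.card {f // S.label f ≠ m.1 ∧ f ≠ e₀.1 ∧ side (S.src f)} +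
        Nat.card {v // S.Meets C v ∧ ¬ S.letters v ⊆ C ∧ side v} := by
  rw [← Nat.card_sum]
  refine (Nat.card_congr (Equiv.ofBijective (Sum.elim
    (fun f => ⟨⟨.inl ⟨f.1, f.2.1⟩, survives_edge_inl hS hC _⟩, fun h => f.2.2.1
      (congrArg Subtype.val (Sum.inl_injective ((congrArg Subtype.val h).trans he))),
      (side_base_attach hS hm (f.1, false)).2 f.2.2.2⟩)
    (fun v => ⟨⟨.inr ⟨v.1, v.2.1⟩, (survives_edge_inr_iff hS hC _).2 v.2.2.1⟩,
      fun h => Sum.inr_ne_inl ((congrArg Subtype.val h).trans he),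
      (side_base_tip_inr hS hm ⟨v.1, v.2.1⟩ false).2 v.2.2.2⟩)) ⟨?_, ?_⟩)).symm
  · rintro (⟨v, hv⟩ | ⟨v, hv⟩) (⟨w, hw⟩ | ⟨w, hw⟩) h <;>
      replace h := Subtype.mk.inj (Subtype.mk.inj h)
    · obtain rfl := Subtype.mk.inj (Sum.inl_injective h); rfl
    · cases h
    · cases h
    · obtain rfl := Subtype.mk.inj (Sum.inr_injective h); rfl
  · rintro ⟨⟨f | v, hz⟩, hne, hs⟩
    · refine ⟨.inl ⟨f.1, f.2, fun h => hne ?_, ?_⟩, rfl⟩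
      · exact Subtype.ext ((congrArg Sum.inl (Subtype.ext h)).trans he.symm)
      · exact (side_base_attach hS hm (f.1, false)).1 hs
    · refine ⟨.inr ⟨v.1, v.2, (survives_edge_inr_iff hS hC _).1 hz, ?_⟩, rfl⟩
      exact (side_base_tip_inr hS hm v false).1 hs

/-- In a folded digraph an `m`-edge is determined by the vertex at which it ends. -/
theorem card_multiplier_edges [Finite S.E] (hS : S.Folded) {side : S.V → Prop}
    (hm : ∀ f, S.label f = m.1 → (side (S.src f) ↔ side (S.tgt f))) {e : S.E}
    (he : S.label e ≠ m.1) :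
    Nat.card {f // f ≠ e ∧ side (S.src f)} =
      Nat.card {f // S.label f ≠ m.1 ∧ f ≠ e ∧ side (S.src f)} +
        Nat.card {v // m ∈ S.letters v ∧ side v} := by
  have htip : ∀ f, S.label f = m.1 → (side (S.src f) ↔ side (S.tip (f, m.2))) := by
    intro f hf
    cases m.2
    · exact Iff.rfl
    · exact hm f hf
  have hv : Nat.card {f // S.label f = m.1 ∧ f ≠ e ∧ side (S.src f)} =
      Nat.card {v // m ∈ S.letters v ∧ side v} := by
    refine Nat.card_congr (Equiv.ofBijective (fun f => ⟨S.tip (f.1, m.2),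
      mem_letters_of_label f.2.1, (htip _ f.2.1).1 f.2.2.2⟩) ⟨?_, ?_⟩)
    · intro f g h
      exact Subtype.ext (hS.eq_of_tip (f.2.1.trans g.2.1.symm) (Subtype.mk.inj h))
    · rintro ⟨v, hmv, hs⟩
      obtain ⟨f, hf, rfl⟩ := exists_of_mem_letters hmv
      exact ⟨⟨f, hf, fun h => he (h ▸ hf), (htip f hf).2 hs⟩, rfl⟩
  rw [← hv]
  classical
  have := Fintype.ofFinite S.E
  simp only [Nat.card_eq_fintype_card, Fintype.card_subtype, Finset.card_filter,
    ← Finset.sum_add_distrib]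
  refine Finset.sum_congr rfl fun f _ => ?_
  by_cases S.label f = m.1 <;> by_cases f ≠ e ∧ side (S.src f) <;> simp_all

theorem propertyL_whiteheadCore (hS : S.IsStallingsGraph) (hC : Whitehead.IsCut C m)
    (hdeg : ∀ v, ∃ a b, a ≠ b ∧ S.tip a = v ∧ S.tip b = v) {e : S.E}
    (hu : ∀ f, S.label f = S.label e → f = e) {side : S.V → Prop} (hs : S.Splits e side)
    (he : S.label e ≠ m.1) : (S.whiteheadCore C m).PropertyL := by
  have hV := hS.finite_V
  have hE := hS.finite_E
  have hF := hS.folded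
  have hdeg' : ∀ v, ∃ a, S.tip a = v := fun v => (hdeg v).imp fun _ ⟨_, _, h, _⟩ => h
  have hm : ∀ f, S.label f = m.1 → (side (S.src f) ↔ side (S.tgt f)) := fun f hf =>
    hs.side_iff f fun h => he (h ▸ hf)
  set e' : (S.whiteheadCore C m).E := ⟨.inl ⟨e, he⟩, survives_edge_inl hF hC _⟩ with he'
  have hne : ∀ v h, (⟨.inr v, h⟩ : (S.whiteheadCore C m).E) ≠ e' := by
    intro v h h'
    cases Subtype.mk.inj h'
  -- The relation is connectivity after removal of `e'`; it still contains all multiplier edges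
  -- because `e'` is not one of them.
  obtain ⟨ρ, h0, h1, h2, h3⟩ := exists_retract hF hC hdeg'
    ((S.whiteheadCore C m).deleteEdge e').joined
    fun v h => ((S.whiteheadCore C m).deleteEdge e').joined_edge
      (⟨⟨.inr v, h⟩, hne v h⟩ : {f // f ≠ e'})
  have hside : ∀ v, side (base (ρ v).1) ↔ side v := by
    intro v
    rcases h0 v with h | ⟨hv, h⟩ <;> rw [h]
    · exact Iff.rfl
    · exact side_base_primed hF hm hv
  have key : ∀ {a b}, (S.deleteEdge e).joined a b →
      ((S.whiteheadCore C m).deleteEdge e').joined (ρ a) (ρ b) := by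
    refine joined_map (S := S.deleteEdge e) (T := (S.whiteheadCore C m).deleteEdge e') ρ ?_
    rintro ⟨f, hfe⟩
    by_cases hf : S.label f = m.1
    · exact h2 f hf
    · refine h3 ⟨f, hf⟩ (survives_edge_inl hF hC _)
        (((S.whiteheadCore C m).deleteEdge e').joined_edge
          (⟨⟨.inl ⟨f, hf⟩, survives_edge_inl hF hC _⟩, fun h => hfe ?_⟩ : {f // f ≠ e'}))
      exact Subtype.mk.inj (Sum.inl_injective (Subtype.mk.inj h))
  rw [propertyL_iff]
  refine ⟨isStallingsGraph_whiteheadCore hS hC hdeg, e', ?_, fun z => side (base z.1),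
    ?_, ?_, ?_, ?_, ?_⟩
  · rintro ⟨f | v, h⟩ hl
    · exact Subtype.ext (congrArg Sum.inl (Subtype.ext (hu f.1 hl)))
    · exact absurd hl.symm he
  · rintro ⟨f | v, h⟩ hfe
    · refine (side_base_attach hF hm (f.1, false)).trans (Iff.trans ?_
        (side_base_attach hF hm (f.1, true)).symm)
      exact hs.side_iff f.1 fun h' => hfe (Subtype.ext (congrArg Sum.inl (Subtype.ext h')))
    · exact (side_base_tip_inr hF hm v false).trans (side_base_tip_inr hF hm v true).symm
  · intro a b hab
    exact Setoid.trans' _ (h1 a) (Setoid.trans' _ (key (hs.joined _ _ hab)) (Setoid.symm' _ (h1 b)))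
  · obtain ⟨a, ha⟩ := hs.exists_side
    exact ⟨ρ a, (hside a).2 ha⟩
  · obtain ⟨a, ha⟩ := hs.exists_not_side
    exact ⟨ρ a, fun h => ha ((hside a).1 h)⟩
  -- The non-multiplier edges cancel, and inclusion-exclusion on this side reduces the equality to
  -- that for `S`.
  · refine (card_whiteheadCore_E hF hC hm e' ⟨e, he⟩ rfl).trans
      (Eq.trans ?_ (card_whiteheadCore_V side).symm)
    change Nat.card {f // S.label f ≠ m.1 ∧ f ≠ e ∧ side (S.src f)} + _ = _
    have c3 := card_multiplier_edges hF hm he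
    have c4 := Nat.card_subtype_inclusion_exclusion (s := side) (M := S.Meets C)
      (B := fun v => S.letters v ⊆ C) (N := fun v => m ∈ S.letters v)
      (fun v hv => meets_of_subset (hdeg' v) hv) (fun v hv => ⟨m, hv, hC.1⟩)
    have c5 := hs.card_eq
    omega

theorem omitsLetter_whiteheadCore (hS : S.IsStallingsGraph) (hC : Whitehead.IsCut C m)
    (hdeg : ∀ v, ∃ a, S.tip a = v) {e : S.E}
    (hu : ∀ f, S.label f = S.label e → f = e) (he : S.label e = m.1)
    (hcard : Nat.card (S.whiteheadCore C m).V < Nat.card S.V) :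
    (S.whiteheadCore C m).OmitsLetter := by
  have hV := hS.finite_V
  have c2 := card_whiteheadCore_V (S := S) (C := C) (m := m) fun _ => True
  have c4 := Nat.card_subtype_inclusion_exclusion (s := fun _ => True) (M := S.Meets C)
    (B := fun v => S.letters v ⊆ C) (N := fun v => m ∈ S.letters v)
    (fun v hv => meets_of_subset (hdeg v) hv) (fun v hv => ⟨m, hv, hC.1⟩)
  have c5 : Nat.card {v // m ∈ S.letters v ∧ True} ≤ 1 := by
    rw [Finite.card_le_one_iff_subsingleton]
    have huniq : ∀ v, m ∈ S.letters v → v = S.tip (e, m.2) := by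
      intro v hv
      obtain ⟨f, hf, rfl⟩ := exists_of_mem_letters hv
      rw [hu f (hf.trans he.symm)]
    exact ⟨fun a b => Subtype.ext ((huniq _ a.2.1).trans (huniq _ b.2.1).symm)⟩
  have c6 : Nat.card {v : S.V // True} = Nat.card S.V :=
    Nat.card_congr (Equiv.subtypeUnivEquiv fun _ => trivial)
  have c7 : Nat.card {z : (S.whiteheadCore C m).V // True} = Nat.card (S.whiteheadCore C m).V :=
    Nat.card_congr (Equiv.subtypeUnivEquiv fun _ => trivial)
  -- By `c2` and `c4` this number is #V of the core − #V + |N|. The first difference is negative and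
  -- |N| ≤ 1.
  have c8 : Nat.card {v // S.Meets C v ∧ ¬ S.letters v ⊆ C ∧ True} = 0 := by omega
  have hempty := (Nat.card_eq_zero.1 c8).resolve_right fun h => h.not_finite inferInstance
  refine ⟨m.1, ?_⟩
  rintro ⟨f | v, h⟩
  · exact f.2
  · exact fun _ => hempty.false
      ⟨v.1, v.2, (survives_edge_inr_iff hS.folded hC v).1 h, trivial⟩

theorem nonempty_iso_image [DecidableEq X] (hS : S.IsStallingsGraph) (hC : Whitehead.IsCut C m)
    (hdeg : ∀ v, ∃ a b, a ≠ b ∧ S.tip a = v ∧ S.tip b = v) :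
    Nonempty (Iso (S.image (Whitehead.aut C m)) (S.whiteheadCore C m)) := by
  have := hS.finite_V
  obtain ⟨φ⟩ := nonempty_iso_fold_whitehead (C := C) (m := m) hS.folded hC
  have hfin : Finite (S.subdivide (whiteheadWord C m)).fold.V :=
    have : Finite (S.whitehead C m).V :=
      inferInstanceAs (Finite (S.V ⊕ {v // S.Meets C v ∧ m ∉ S.letters v}))
    Finite.of_equiv _ φ.V.symm
  obtain ⟨ψ⟩ := ((isCore_whitehead hS.folded hC hdeg).comap φ).nonempty_iso_cyclicReduction
  rw [image, show (fun x => (Whitehead.aut C m (FreeGroup.of x)).toWord) = whiteheadWord C m from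
    funext fun x => toWord_aut x]
  exact ⟨ψ.trans (φ.induce _)⟩

end Whitehead

end XDigraph

theorem mainTheorem6 {X : Type u} [Finite X] [DecidableEq X] (S : XDigraph.{u, v} X)
    (hS : S.CyclicallyReduced) (hL : S.PropertyL)
    (C : Set (X × Bool)) (m : X × Bool) (hC : Whitehead.IsCut C m)
    (hred : S.Reduces (Whitehead.aut C m)) :
    (S.image (Whitehead.aut C m)).PropertyL ∨ (S.image (Whitehead.aut C m)).OmitsLetter := by
  obtain ⟨hSt, e, hu, side, hs⟩ := S.propertyL_iff.1 hL
  have hdeg := hS.exists_tip_ne hSt.connected e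
  obtain ⟨φ⟩ := XDigraph.nonempty_iso_image hSt hC hdeg
  -- The reduction hypothesis enters only when the multiplier is the label of the separating edge.
  by_cases he : S.label e = m.1
  · refine .inr (φ.omitsLetter (XDigraph.omitsLetter_whiteheadCore hSt hC
      (fun v => hSt.connected.exists_tip e v) hu he ?_))
    rw [← Nat.card_congr φ.V]
    exact hred
  · exact .inl (φ.propertyL (XDigraph.propertyL_whiteheadCore hSt hC hdeg hu hs he))
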